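/- Let $a,L>0$ with $a<L/2$ and $0<b_0<b_1$. Put $x_\ell=(-L/2,0)$, $x_r=(L/2,0)$. Let $\beta:[0,\infty)\to\mathbb R$ be smooth with $\beta(0)=b_0$, $\beta'(0)>0$, $b_0<\beta(u)\le b_1$ for $u>0$ and $\beta(u)=b_1$ for $u>a^2/2$. Let $B_\ell(x)=\beta(|x-x_\ell|^2/2)$, $B_r(x_1,x_2)=B_\ell(-x_1,x_2)$, and let $B$ equal $B_\ell$ on $\{|x-x_\ell|\le a\}$, $B_r$ on $\{|x-x_r|\le a\}$ and $b_1$ elsewhere. Put $M=\frac1{4\pi}\int_{\mathbb R^2}(B(x)-b_1)\,\mathrm dx$. Let $\mathbf A=(0,A_2)$ be a smooth vector potential with $\partial_1A_2=B$, and for $\star\in\{\ell,r\}$ let $$\mathbf A_\star(x)=\int_0^1B_\star(x_\star+t(x-x_\star))\,t\,(x-x_\star)^\perp\,\mathrm dt,\qquad (v_1,v_2)^\perp=(-v_2,v_1).$$ With line integrals along the straight segment $[0,x]$, put $$\sigma_\star(x)=\int_{[0,x]}(\mathbf A-\mathbf A_\star)\cdot\mathrm ds,\qquad \theta=\sigma_r-\sigma_\ell,\qquad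 k=\partial_1\sigma_\ell+\partial_1\sigma_r.$$ Then $\theta(x)=\int_{[0,x]}(\mathbf A_\ell-\mathbf A_r)\cdot\mathrm ds$ for all $x$; $\sigma_\ell$ and $\sigma_r$ are differentiable at the points of the line $x_1=0$; and for all $x_2\in\mathbb R$ $$\theta(0,x_2)=\frac{b_1Lx_2}{2}+2M\arctan(2x_2/L),\qquad k(0,x_2)=b_1x_2+\frac{2Mx_2}{L^2/4+x_2^2}.$$ Moreover, let $h>0$ be such that the magnetic Laplacians $\mathscr L_{h,\star}=(-ih\nabla-\mathbf A_\star)^2$ on $L^2(\mathbb R^2)$ have positive $L^2$-normalized groundstates $\phi_\star$, $\star\in\{\ell,r\}$ (smooth eigenfunctions for the smallest eigenvalue), and let $\mu_h$ be the smallest eigenvalue of $\mathscr L_{h,\ell}$. Let $0<\eta<L/2-a$, and let $\chi_\ell,\chi_r$ be smooth real functions of $x_1$ such that $\chi_\ell=1$ for $x_1<\frac L2-a-\eta$, $\chi_\ell=0$ for $x_1>\frac L2-a-\frac\eta2$, $\chi_r=1$ for $x_1>-(\frac L2-a-\eta)$ and $\chi_r=0$ for $x_1<-(\frac L2-a-\frac\eta2)$.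 Let $\mathscr L_h=(-ih\nabla-\mathbf A)^2$, $\tilde\phi_\star=\chi_\star e^{i\sigma_\star/h}\phi_\star$ and $$w_h=\langle(\mathscr L_h-\mu_h)\tilde\phi_\ell,\tilde\phi_r\rangle_{L^2(\mathbb R^2)},$$ with the scalar product linear in its first argument. Then $(\mathscr L_h-\mu_h)\tilde\phi_\ell$ and $\tilde\phi_r$ belong to $L^2(\mathbb R^2)$, and $$w_h=h^2\int_{\mathbb R}\Big(2\,\partial_1\phi_\ell(0,x_2)\,\phi_\ell(0,x_2)+i\,\frac{k(0,x_2)}{h}\,\phi_\ell(0,x_2)^2\Big)e^{-i\theta(0,x_2)/h}\,\mathrm dx_2,$$ where the integral converges absolutely. -/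

import Mathlib

open MeasureTheory Set
open scoped ContDiff

namespace MagneticDoubleWell

/-! The plane is `ℝ × ℝ` with Lebesgue measure.  Its built-in norm is never used: Euclidean
distances are written out through `distSq`. -/

/-- The square `|x - p|²` of the Euclidean distance. -/
def distSq (p x : ℝ × ℝ) : ℝ := (x.1 - p.1) ^ 2 + (x.2 - p.2) ^ 2

/-- The bottom `x_ℓ = (-L/2, 0)` of the left well. -/
noncomputable def leftWell (L : ℝ) : ℝ × ℝ := (-(L / 2), 0)

/-- The bottom `x_r = (L/2, 0)` of the right well. -/
noncomputable def rightWell (L : ℝ) : ℝ × ℝ := (L / 2, 0)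

/-- The admissible magnetic profiles `β : [0, ∞) → ℝ`; only the values on `[0, ∞)` matter.
The left field is `B_ℓ(x) = β(|x - x_ℓ|² / 2)`, whose Hessian at `x_ℓ` is `β'(0)` times the
identity, so that `0 < β'(0)` says that the minimum is non-degenerate. -/
structure IsProfile (a b₀ b₁ : ℝ) (β : ℝ → ℝ) : Prop where
  smooth : ContDiffOn ℝ ∞ β (Ici 0)
  value_zero : β 0 = b₀
  unique_min : ∀ u, 0 < u → b₀ < β u
  nondegenerate : 0 < derivWithin β (Ici 0) 0
  le_top : ∀ u, 0 ≤ u → β u ≤ b₁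
  eq_top : ∀ u, a ^ 2 / 2 < u → β u = b₁

/-- The left magnetic field `B_ℓ`. -/
noncomputable def leftField (L : ℝ) (β : ℝ → ℝ) (x : ℝ × ℝ) : ℝ :=
  β (distSq (leftWell L) x / 2)

/-- The right magnetic field `B_r(x₁, x₂) = B_ℓ(-x₁, x₂)`. -/
noncomputable def rightField (L : ℝ) (β : ℝ → ℝ) (x : ℝ × ℝ) : ℝ :=
  leftField L β (-x.1, x.2)

open Classical in
/-- The double well magnetic field `B`. -/
noncomputable def doubleField (a L b₁ : ℝ) (β : ℝ → ℝ) (x : ℝ × ℝ) : ℝ :=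
  if distSq (leftWell L) x ≤ a ^ 2 then leftField L β x
  else if distSq (rightWell L) x ≤ a ^ 2 then rightField L β x
  else b₁

/-- The flux difference `M = (4π)⁻¹ ∫ (B - b₁) dx`. -/
noncomputable def fluxDifference (a L b₁ : ℝ) (β : ℝ → ℝ) : ℝ :=
  1 / (4 * Real.pi) * ∫ x : ℝ × ℝ, (doubleField a L b₁ β x - b₁)

/-- The partial derivative `∂₁ f`. -/
noncomputable def partial₁ {E : Type*} [NormedAddCommGroup E] [NormedSpace ℝ E]
    (f : ℝ × ℝ → E) (x : ℝ × ℝ) : E := fderiv ℝ f x (1, 0)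

/-- The partial derivative `∂₂ f`. -/
noncomputable def partial₂ {E : Type*} [NormedAddCommGroup E] [NormedSpace ℝ E]
    (f : ℝ × ℝ → E) (x : ℝ × ℝ) : E := fderiv ℝ f x (0, 1)

/-- The magnetic field `∂₁ A₂ - ∂₂ A₁` of a vector potential `A = (A₁, A₂)`. -/
noncomputable def curl (A : ℝ × ℝ → ℝ × ℝ) (x : ℝ × ℝ) : ℝ :=
  partial₁ (fun y => (A y).2) x - partial₂ (fun y => (A y).1) x

/-- The vector potential `∫₀¹ B(p + t (x - p)) t (x - p)^⊥ dt`, where `v^⊥ = (-v₂, v₁)`. -/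
noncomputable def radialPotential (B : ℝ × ℝ → ℝ) (p x : ℝ × ℝ) : ℝ × ℝ :=
  ∫ t in (0 : ℝ)..1, (B (p + t • (x - p)) * t) • ((-(x - p).2, (x - p).1) : ℝ × ℝ)

/-- The one-well vector potential `A_ℓ`. -/
noncomputable def leftPotential (L : ℝ) (β : ℝ → ℝ) : ℝ × ℝ → ℝ × ℝ :=
  radialPotential (leftField L β) (leftWell L)

/-- The one-well vector potential `A_r`. -/
noncomputable def rightPotential (L : ℝ) (β : ℝ → ℝ) : ℝ × ℝ → ℝ × ℝ :=
  radialPotential (rightField L β) (rightWell L)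

/-- The first component `-ih ∂₁ - A₁` of `-ih∇ - A`. -/
noncomputable def momentum₁ (h : ℝ) (A : ℝ × ℝ → ℝ × ℝ) (u : ℝ × ℝ → ℂ) (x : ℝ × ℝ) : ℂ :=
  -Complex.I * h * partial₁ u x - ((A x).1 : ℂ) * u x

/-- The second component `-ih ∂₂ - A₂` of `-ih∇ - A`. -/
noncomputable def momentum₂ (h : ℝ) (A : ℝ × ℝ → ℝ × ℝ) (u : ℝ × ℝ → ℂ) (x : ℝ × ℝ) : ℂ :=
  -Complex.I * h * partial₂ u x - ((A x).2 : ℂ) * u x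

/-- The magnetic Laplacian `(-ih∇ - A)²`. -/
noncomputable def magneticLaplacian (h : ℝ) (A : ℝ × ℝ → ℝ × ℝ) (u : ℝ × ℝ → ℂ)
    (x : ℝ × ℝ) : ℂ :=
  momentum₁ h A (momentum₁ h A u) x + momentum₂ h A (momentum₂ h A u) x

/-- The eigenvalues of the self-adjoint magnetic Laplacian on `L²(ℝ²)`.  For a smooth `A` this
operator is essentially self-adjoint on test functions and elliptic, so its eigenfunctions are
exactly the nonzero smooth square-integrable solutions of the eigenvalue equation. -/
def eigenvalues (h : ℝ) (A : ℝ × ℝ → ℝ × ℝ) : Set ℝ :=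
  {μ | ∃ u : ℝ × ℝ → ℂ, ContDiff ℝ ∞ u ∧ MemLp u 2 volume ∧ u ≠ 0 ∧
    ∀ x, magneticLaplacian h A u x = μ * u x}

/-- `φ` is a positive `L²`-normalized groundstate of `(-ih∇ - A)²`, and `μ` is the smallest
eigenvalue. -/
structure IsPositiveGroundstate (h : ℝ) (A : ℝ × ℝ → ℝ × ℝ) (μ : ℝ) (φ : ℝ × ℝ → ℝ) : Prop where
  least : IsLeast (eigenvalues h A) μ
  smooth : ContDiff ℝ ∞ φ
  pos : ∀ x, 0 < φ x
  normalized : ∫ x, φ x ^ 2 = 1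
  equation : ∀ x, magneticLaplacian h A (fun y => (φ y : ℂ)) x = μ * (φ x : ℂ)

/-- The line integral `∫_{[0,x]} F · ds` along the straight segment from `0` to `x`. -/
noncomputable def segmentIntegral (F : ℝ × ℝ → ℝ × ℝ) (x : ℝ × ℝ) : ℝ :=
  ∫ t in (0 : ℝ)..1, ((F (t • x)).1 * x.1 + (F (t • x)).2 * x.2)

/-- The gauge function `σ_ℓ(x) = ∫_{[0,x]} (A - A_ℓ) · ds`. -/
noncomputable def sigmaLeft (L : ℝ) (β : ℝ → ℝ) (A : ℝ × ℝ → ℝ × ℝ) : ℝ × ℝ → ℝ :=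
  segmentIntegral (fun y => A y - leftPotential L β y)

/-- The gauge function `σ_r(x) = ∫_{[0,x]} (A - A_r) · ds`. -/
noncomputable def sigmaRight (L : ℝ) (β : ℝ → ℝ) (A : ℝ × ℝ → ℝ × ℝ) : ℝ × ℝ → ℝ :=
  segmentIntegral (fun y => A y - rightPotential L β y)

/-- The interaction phase `θ = σ_r - σ_ℓ`. -/
noncomputable def theta (L : ℝ) (β : ℝ → ℝ) (A : ℝ × ℝ → ℝ × ℝ) (x : ℝ × ℝ) : ℝ :=
  sigmaRight L β A x - sigmaLeft L β A x

/-- The coefficient `k = ∂₁ σ_ℓ + ∂₁ σ_r`. -/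
noncomputable def kCoeff (L : ℝ) (β : ℝ → ℝ) (A : ℝ × ℝ → ℝ × ℝ) (x : ℝ × ℝ) : ℝ :=
  partial₁ (sigmaLeft L β A) x + partial₁ (sigmaRight L β A) x

/-- A smooth cutoff in the variable `x₁`, equal to `1` for `x₁ < L/2 - a - η` and to `0` for
`x₁ > L/2 - a - η/2`. -/
structure IsLeftCutoff (a L η : ℝ) (χ : ℝ → ℝ) : Prop where
  smooth : ContDiff ℝ ∞ χ
  eq_one : ∀ s, s < L / 2 - a - η → χ s = 1
  eq_zero : ∀ s, L / 2 - a - η / 2 < s → χ s = 0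

/-- The mirror image: a smooth cutoff in `x₁`, equal to `1` for `x₁ > -(L/2 - a - η)` and to `0`
for `x₁ < -(L/2 - a - η/2)`. -/
structure IsRightCutoff (a L η : ℝ) (χ : ℝ → ℝ) : Prop where
  smooth : ContDiff ℝ ∞ χ
  eq_one : ∀ s, -(L / 2 - a - η) < s → χ s = 1
  eq_zero : ∀ s, s < -(L / 2 - a - η / 2) → χ s = 0

/-- The quasimode `χ(x₁) e^{iσ(x)/h} φ(x)`. -/
noncomputable def quasimode (h : ℝ) (χ : ℝ → ℝ) (σ φ : ℝ × ℝ → ℝ) (x : ℝ × ℝ) : ℂ :=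
  (χ x.1 : ℂ) * (Complex.exp (Complex.I * σ x / h) * (φ x : ℂ))

/-- The function `(ℒ_h - μ) u`, for the magnetic Laplacian `ℒ_h` with potential `A`. -/
noncomputable def residual (h : ℝ) (A : ℝ × ℝ → ℝ × ℝ) (μ : ℝ) (u : ℝ × ℝ → ℂ)
    (x : ℝ × ℝ) : ℂ :=
  magneticLaplacian h A u x - μ * u x

/-- The `L²(ℝ²)` scalar product, linear in the first argument. -/
noncomputable def scalarProduct (u v : ℝ × ℝ → ℂ) : ℂ :=
  ∫ x, u x * (starRingEnd ℂ) (v x)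

/-- The integrand of the interaction integral on the symmetry line, at the point `(0, y)`. -/
noncomputable def interactionIntegrand (h L : ℝ) (β : ℝ → ℝ) (A : ℝ × ℝ → ℝ × ℝ)
    (φ : ℝ × ℝ → ℝ) (y : ℝ) : ℂ :=
  (2 * ((partial₁ φ (0, y) : ℝ) : ℂ) * (φ (0, y) : ℂ)
      + Complex.I * ((kCoeff L β A (0, y) : ℂ) / h) * (φ (0, y) : ℂ) ^ 2)
    * Complex.exp (-Complex.I * (theta L β A (0, y) : ℂ) / h)

end MagneticDoubleWell

namespace MagneticDoubleWell

/-! ### Integrals depending on a parameter -/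

/-! Phase and coefficient. On the half-plane `x.1 < L / 2 - a` the potentials `A` and `A_ℓ` have the
same curl, and the half-plane contains every segment from the origin to its points, so `∇σ_ℓ = A -
A_ℓ` there (`fderiv_sigmaLeft`); the mirror statement holds for `σ_r`. Since `A_ℓ` is an angular
field about the left well, its circulation is a flux, and outside the well its scalar factor is
exactly `b₁ / 2 + M / |x - x_ℓ|²` (`leftFactor_of_le_distSq`). The explicit formulas on the symmetry
line follow.

Groundstates. `A_ℓ` is divergence free, so for a real eigenfunction the imaginary part of the
equation is `A_ℓ · ∇φ = 0`: the positive groundstate is radial. Its profile solves a singular ODE,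
and a Wronskian argument gives uniqueness (`groundstate_unique`). Reflection combined with complex
conjugation exchanges the two wells, hence `φ_r` is the mirror image of `φ_ℓ` and has the same
eigenvalue. The ODE also gives polynomial decay (`groundstate_decay`), enough for all boundary terms
at infinity.

Interaction. Applying `ℒ_h - μ` to the left quasimode leaves only the commutator with the cutoff,
supported in a strip where the right cutoff is `1` and both gauges are valid. There the integrand of
`w_h` is `-ih` times the divergence of a current (`divergence_current`). The divergence theorem on
`0 < x.1 < c` moves the integral to the symmetry line, where the mirror symmetry turns the normal
current into the stated integrand (`current₁_symmetryLine`). -/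

theorem hasFDerivAt_parametric_intervalIntegral {H E : Type*} [NormedAddCommGroup H]
    [NormedSpace ℝ H] [ProperSpace H] [NormedAddCommGroup E] [NormedSpace ℝ E]
    {F : H × ℝ → E} (hF : ContDiff ℝ 1 F) (a b : ℝ) (x : H) :
    HasFDerivAt (fun y => ∫ t in a..b, F (y, t))
      (∫ t in a..b, (fderiv ℝ F (x, t)).comp (ContinuousLinearMap.inl ℝ H ℝ)) x := by
  have hd : Continuous fun z : H × ℝ =>
      (fderiv ℝ F z).comp (ContinuousLinearMap.inl ℝ H ℝ) :=
    (hF.continuous_fderiv one_ne_zero).clm_comp continuous_const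
  obtain ⟨C, hC⟩ := ((isCompact_closedBall x 1).prod (isCompact_uIcc (a := a) (b := b))
    ).exists_bound_of_continuousOn hd.continuousOn
  refine intervalIntegral.hasFDerivAt_integral_of_dominated_of_fderiv_le
    (F := fun y t => F (y, t))
    (F' := fun y t => (fderiv ℝ F (y, t)).comp (ContinuousLinearMap.inl ℝ H ℝ))
    (bound := fun _ => C) (Metric.closedBall_mem_nhds x one_pos) ?_ ?_ ?_ ?_ ?_ ?_
  · exact .of_forall fun y =>
      (hF.continuous.comp (Continuous.prodMk_right y)).aestronglyMeasurable
  · exact (hF.continuous.comp (Continuous.prodMk_right x)).intervalIntegrable _ _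
  · exact (hd.comp (Continuous.prodMk_right x)).aestronglyMeasurable
  · exact .of_forall fun t ht y hy => hC (y, t) ⟨hy, uIoc_subset_uIcc ht⟩
  · simp
  · refine .of_forall fun t _ y _ => ?_
    exact ((hF.differentiable one_ne_zero (y, t)).hasFDerivAt).comp y (hasFDerivAt_prodMk_left y t)

theorem contDiff_one_parametric_intervalIntegral {H E : Type*} [NormedAddCommGroup H]
    [NormedSpace ℝ H] [ProperSpace H] [NormedAddCommGroup E] [NormedSpace ℝ E]
    {F : H × ℝ → E} (hF : ContDiff ℝ 1 F) (a b : ℝ) :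
    ContDiff ℝ 1 (fun y => ∫ t in a..b, F (y, t)) := by
  rw [contDiff_one_iff_hasFDerivAt]
  refine ⟨_, ?_, fun x => hasFDerivAt_parametric_intervalIntegral hF a b x⟩
  have hd : Continuous fun z : H × ℝ =>
      (fderiv ℝ F z).comp (ContinuousLinearMap.inl ℝ H ℝ) :=
    (hF.continuous_fderiv one_ne_zero).clm_comp continuous_const
  exact intervalIntegral.continuous_parametric_intervalIntegral_of_continuous' hd a b

theorem fderiv_parametric_intervalIntegral {H E : Type*} [NormedAddCommGroup H]
    [NormedSpace ℝ H] [ProperSpace H] [NormedAddCommGroup E] [NormedSpace ℝ E] [CompleteSpace E]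
    {F : H × ℝ → E} (hF : ContDiff ℝ 1 F) (a b : ℝ) (x v : H) :
    fderiv ℝ (fun y => ∫ t in a..b, F (y, t)) x v
      = ∫ t in a..b, fderiv ℝ (fun y => F (y, t)) x v := by
  have hd : Continuous fun z : H × ℝ =>
      (fderiv ℝ F z).comp (ContinuousLinearMap.inl ℝ H ℝ) :=
    (hF.continuous_fderiv one_ne_zero).clm_comp continuous_const
  have hi : IntervalIntegrable (fun t : ℝ =>
      (fderiv ℝ F (x, t)).comp (ContinuousLinearMap.inl ℝ H ℝ)) volume a b :=
    (hd.comp (Continuous.prodMk_right x)).intervalIntegrable _ _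
  rw [(hasFDerivAt_parametric_intervalIntegral hF a b x).fderiv,
    ContinuousLinearMap.intervalIntegral_apply hi]
  refine intervalIntegral.integral_congr fun t _ => ?_
  have := (HasFDerivAt.comp (f := fun y => (y, t)) x
    (hF.differentiable one_ne_zero (x, t)).hasFDerivAt (hasFDerivAt_prodMk_left x t)).fderiv
  simp only [Function.comp_def] at this
  simp only [this]

/-! ### Partial derivatives -/

section Partials

variable {E : Type*} [NormedAddCommGroup E] [NormedSpace ℝ E]

theorem fderiv_apply_eq_partials (f : ℝ × ℝ → E) (x v : ℝ × ℝ) :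
    fderiv ℝ f x v = v.1 • partial₁ f x + v.2 • partial₂ f x := by
  rw [partial₁, partial₂, ← map_smul, ← map_smul, ← map_add]
  congr 1
  ext <;> simp

end Partials

/-! ### Line integrals along segments -/

theorem contDiff_segmentIntegral {F : ℝ × ℝ → ℝ × ℝ} (hF : ContDiff ℝ 1 F) :
    ContDiff ℝ 1 (segmentIntegral F) := by
  have : ContDiff ℝ 1 fun z : (ℝ × ℝ) × ℝ =>
      (F (z.2 • z.1)).1 * z.1.1 + (F (z.2 • z.1)).2 * z.1.2 := by fun_prop
  exact contDiff_one_parametric_intervalIntegral this 0 1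

/-- Poincaré lemma in pointwise form: after differentiation under the integral sign, vanishing of
the curl makes the integrand equal to the `t`-derivative of `t F(tx) · v`. Only the curl on the
segment itself enters, so the field need not be closed everywhere. -/
theorem fderiv_segmentIntegral {F : ℝ × ℝ → ℝ × ℝ} (hF : ContDiff ℝ 1 F) {x : ℝ × ℝ}
    (hcurl : ∀ t ∈ Icc (0 : ℝ) 1, curl F (t • x) = 0) (v : ℝ × ℝ) :
    fderiv ℝ (segmentIntegral F) x v = (F x).1 * v.1 + (F x).2 * v.2 := by
  have hI : ContDiff ℝ 1 fun z : (ℝ × ℝ) × ℝ =>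
      (F (z.2 • z.1)).1 * z.1.1 + (F (z.2 • z.1)).2 * z.1.2 := by fun_prop
  have key := fderiv_parametric_intervalIntegral hI 0 1 x v
  change fderiv ℝ (fun y => ∫ t in (0 : ℝ)..1,
    ((F (t • y)).1 * y.1 + (F (t • y)).2 * y.2)) x v = _
  rw [key]
  have h1 : ContDiff ℝ 1 fun y => (F y).1 := by fun_prop
  have h2 : ContDiff ℝ 1 fun y => (F y).2 := by fun_prop
  have hd1 := h1.differentiable one_ne_zero
  have hd2 := h2.differentiable one_ne_zero
  let g : ℝ → ℝ := fun t => t * ((F (t • x)).1 * v.1 + (F (t • x)).2 * v.2)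
  have hsx : ∀ t : ℝ, HasDerivAt (fun s : ℝ => s • x) x t := fun t => by
    simpa using (hasDerivAt_id t).smul_const x
  have hg : ∀ t : ℝ, HasDerivAt g (((F (t • x)).1 * v.1 + (F (t • x)).2 * v.2)
      + t * (fderiv ℝ (fun y => (F y).1) (t • x) x * v.1
        + fderiv ℝ (fun y => (F y).2) (t • x) x * v.2)) t := fun t => by
    have a1 := (hd1 (t • x)).hasFDerivAt.comp_hasDerivAt t (hsx t)
    have a2 := (hd2 (t • x)).hasFDerivAt.comp_hasDerivAt t (hsx t)
    have := (hasDerivAt_id t).mul ((a1.mul_const v.1).add (a2.mul_const v.2))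
    convert! this using 1
    simp
  have hcont : Continuous fun t : ℝ => ((F (t • x)).1 * v.1 + (F (t • x)).2 * v.2)
      + t * (fderiv ℝ (fun y => (F y).1) (t • x) x * v.1
        + fderiv ℝ (fun y => (F y).2) (t • x) x * v.2) := by
    have b1 : Continuous fun t : ℝ => fderiv ℝ (fun y => (F y).1) (t • x) x :=
      ((h1.continuous_fderiv one_ne_zero).comp (by fun_prop)).clm_apply continuous_const
    have b2 : Continuous fun t : ℝ => fderiv ℝ (fun y => (F y).2) (t • x) x :=
      ((h2.continuous_fderiv one_ne_zero).comp (by fun_prop)).clm_apply continuous_const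
    have := hF.continuous
    fun_prop
  have hFTC := intervalIntegral.integral_eq_sub_of_hasDerivAt (fun t _ => hg t)
    (hcont.intervalIntegrable 0 1)
  have hend : g 1 - g 0 = (F x).1 * v.1 + (F x).2 * v.2 := by simp [g]
  rw [← hend, ← hFTC]
  refine intervalIntegral.integral_congr fun t ht => ?_
  rw [uIcc_of_le zero_le_one] at ht
  have hc := hcurl t ht
  rw [curl] at hc
  have hsy : HasFDerivAt (fun y : ℝ × ℝ => t • y) (t • ContinuousLinearMap.id ℝ (ℝ × ℝ)) x :=
    (hasFDerivAt_id x).const_smul t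
  have c1 := (hd1 (t • x)).hasFDerivAt.comp x hsy
  have c2 := (hd2 (t • x)).hasFDerivAt.comp x hsy
  have := ((c1.mul (hasFDerivAt_fst (𝕜 := ℝ) (p := x))).add
    (c2.mul (hasFDerivAt_snd (𝕜 := ℝ) (p := x)))).fderiv
  simp only [Function.comp_def] at this
  have e : fderiv ℝ (fun y : ℝ × ℝ => (F (t • y)).1 * y.1 + (F (t • y)).2 * y.2) x = _ := this
  simp only [e]
  simp only [add_apply, smul_apply,
    ContinuousLinearMap.comp_apply, ContinuousLinearMap.coe_fst', ContinuousLinearMap.coe_snd',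
    ContinuousLinearMap.id_apply, map_smul, smul_eq_mul, fderiv_apply_eq_partials]
  -- The two integrands differ by `t (v₁ x₂ - v₂ x₁)` times the curl at `t • x`.
  linear_combination t * (v.1 * x.2 - v.2 * x.1) * hc

theorem segmentIntegral_sub {F G : ℝ × ℝ → ℝ × ℝ} (hF : Continuous F) (hG : Continuous G)
    (x : ℝ × ℝ) :
    segmentIntegral (fun y => F y - G y) x = segmentIntegral F x - segmentIntegral G x := by
  unfold segmentIntegral
  rw [← intervalIntegral.integral_sub]
  · refine intervalIntegral.integral_congr fun t _ => ?_
    simp only [Prod.fst_sub, Prod.snd_sub]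
    ring
  · exact Continuous.intervalIntegrable (by fun_prop) _ _
  · exact Continuous.intervalIntegrable (by fun_prop) _ _

/-! ### Radial vector potentials -/

/-- The scalar factor of a radial potential: it multiplies `(x - p)^⊥`. -/
noncomputable def radialFactor (B : ℝ × ℝ → ℝ) (p x : ℝ × ℝ) : ℝ :=
  ∫ t in (0 : ℝ)..1, B (p + t • (x - p)) * t

theorem radialPotential_eq (B : ℝ × ℝ → ℝ) (p x : ℝ × ℝ) :
    radialPotential B p x =
      (-(radialFactor B p x * (x.2 - p.2)), radialFactor B p x * (x.1 - p.1)) := by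
  rw [radialPotential, intervalIntegral.integral_smul_const, radialFactor]
  ext
  · simp only [Prod.smul_fst, Prod.snd_sub, smul_eq_mul]
    ring
  · simp

theorem contDiff_radialFactor {B : ℝ × ℝ → ℝ} (hB : ContDiff ℝ 1 B) (p : ℝ × ℝ) :
    ContDiff ℝ 1 (radialFactor B p) := by
  have : ContDiff ℝ 1 fun z : (ℝ × ℝ) × ℝ => B (p + z.2 • (z.1 - p)) * z.2 := by fun_prop
  exact contDiff_one_parametric_intervalIntegral this 0 1

theorem contDiff_radialPotential {B : ℝ × ℝ → ℝ} (hB : ContDiff ℝ 1 B) (p : ℝ × ℝ) :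
    ContDiff ℝ 1 (radialPotential B p) := by
  have h := contDiff_radialFactor hB p
  have : radialPotential B p = fun x =>
      (-(radialFactor B p x * (x.2 - p.2)), radialFactor B p x * (x.1 - p.1)) :=
    funext (radialPotential_eq B p)
  rw [this]
  fun_prop

/-- The left side is `∫₀¹ d/dt [t² B(p + t(x - p))] dt`. It is also the curl of the radial factor
times `(x - p)^⊥`, which is how it is used. -/
theorem fderiv_radialFactor_radial {B : ℝ × ℝ → ℝ} (hB : ContDiff ℝ 1 B) (p x : ℝ × ℝ) :
    2 * radialFactor B p x + fderiv ℝ (radialFactor B p) x (x - p) = B x := by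
  have hI : ContDiff ℝ 1 fun z : (ℝ × ℝ) × ℝ => B (p + z.2 • (z.1 - p)) * z.2 := by fun_prop
  have key := fderiv_parametric_intervalIntegral hI 0 1 x (x - p)
  change 2 * radialFactor B p x
    + fderiv ℝ (fun y => ∫ t in (0 : ℝ)..1, B (p + t • (y - p)) * t) x (x - p) = B x
  rw [key, radialFactor, ← intervalIntegral.integral_const_mul]
  have hd := hB.differentiable one_ne_zero
  have hder : ∀ t : ℝ, fderiv ℝ (fun y => B (p + t • (y - p)) * t) x (x - p)
      = t ^ 2 * fderiv ℝ B (p + t • (x - p)) (x - p) := fun t => by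
    have hsy : HasFDerivAt (fun y : ℝ × ℝ => p + t • (y - p))
        (t • ContinuousLinearMap.id ℝ (ℝ × ℝ)) x :=
      (((hasFDerivAt_id x).sub_const p).const_smul t).const_add p
    have := (((hd (p + t • (x - p))).hasFDerivAt.comp x hsy).mul_const t).fderiv
    simp only [Function.comp_def] at this
    rw [this]
    simp
    ring
  simp only [hder]
  have hsx : ∀ t : ℝ, HasDerivAt (fun s : ℝ => p + s • (x - p)) (x - p) t := fun t => by
    simpa using ((hasDerivAt_id t).smul_const (x - p)).const_add p
  have hg : ∀ t : ℝ, HasDerivAt (fun t => t ^ 2 * B (p + t • (x - p)))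
      (2 * (B (p + t • (x - p)) * t) + t ^ 2 * fderiv ℝ B (p + t • (x - p)) (x - p)) t := by
    intro t
    have := (hasDerivAt_pow 2 t).mul
      ((hd (p + t • (x - p))).hasFDerivAt.comp_hasDerivAt t (hsx t))
    simp only [Function.comp_def] at this
    convert! this using 1
    push_cast
    ring
  have c1 : Continuous fun t : ℝ => 2 * (B (p + t • (x - p)) * t) := by
    have := hB.continuous
    fun_prop
  have c2 : Continuous fun t : ℝ => t ^ 2 * fderiv ℝ B (p + t • (x - p)) (x - p) := by
    have : Continuous fun t : ℝ => fderiv ℝ B (p + t • (x - p)) (x - p) :=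
      ((hB.continuous_fderiv one_ne_zero).comp (by fun_prop)).clm_apply continuous_const
    fun_prop
  rw [← intervalIntegral.integral_add (c1.intervalIntegrable _ _) (c2.intervalIntegrable _ _),
    intervalIntegral.integral_eq_sub_of_hasDerivAt (fun t _ => hg t)
      ((c1.add c2).intervalIntegrable _ _)]
  simp

theorem curl_radialPotential {B : ℝ × ℝ → ℝ} (hB : ContDiff ℝ 1 B) (p x : ℝ × ℝ) :
    curl (radialPotential B p) x = B x := by
  have h := ((contDiff_radialFactor hB p).differentiable one_ne_zero x).hasFDerivAt
  have e1 := (h.mul ((hasFDerivAt_snd (𝕜 := ℝ) (p := x)).sub_const p.2)).neg.fderiv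
  have e2 := (h.mul ((hasFDerivAt_fst (𝕜 := ℝ) (p := x)).sub_const p.1)).fderiv
  rw [← fderiv_radialFactor_radial hB p x, curl, partial₁, partial₂]
  simp only [radialPotential_eq]
  have e1' : fderiv ℝ (fun y => -(radialFactor B p y * (y.2 - p.2))) x = _ := e1
  have e2' : fderiv ℝ (fun y => radialFactor B p y * (y.1 - p.1)) x = _ := e2
  rw [e1', e2', fderiv_apply_eq_partials _ x (x - p), partial₁, partial₂]
  simp
  ring

/-! ### The reflection exchanging the wells -/

/-- The reflection `(x₁, x₂) ↦ (-x₁, x₂)`. -/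
noncomputable def reflection : (ℝ × ℝ) ≃L[ℝ] (ℝ × ℝ) :=
  (ContinuousLinearEquiv.neg ℝ).prodCongr (ContinuousLinearEquiv.refl ℝ ℝ)

@[simp]
theorem reflection_apply (x : ℝ × ℝ) : reflection x = (-x.1, x.2) := rfl

theorem reflection_reflection (x : ℝ × ℝ) : reflection (reflection x) = x := by simp

theorem measurePreserving_reflection :
    MeasurePreserving reflection (volume : Measure (ℝ × ℝ)) volume :=
  (Measure.measurePreserving_neg (volume : Measure ℝ)).prod (MeasurePreserving.id volume)

theorem integral_comp_reflection {E : Type*} [NormedAddCommGroup E] [NormedSpace ℝ E]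
    (f : ℝ × ℝ → E) : ∫ x, f (reflection x) = ∫ x, f x :=
  measurePreserving_reflection.integral_comp
    reflection.toHomeomorph.measurableEmbedding f

theorem distSq_leftWell_reflection (L : ℝ) (x : ℝ × ℝ) :
    distSq (leftWell L) (reflection x) = distSq (rightWell L) x := by
  simp [distSq, leftWell, rightWell]
  ring

theorem rightField_eq (L : ℝ) (β : ℝ → ℝ) (x : ℝ × ℝ) :
    rightField L β x = leftField L β (reflection x) := rfl

theorem radialFactor_rightField (L : ℝ) (β : ℝ → ℝ) (x : ℝ × ℝ) :
    radialFactor (rightField L β) (rightWell L) x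
      = radialFactor (leftField L β) (leftWell L) (reflection x) := by
  unfold radialFactor
  refine intervalIntegral.integral_congr fun t _ => ?_
  simp only [rightField_eq, reflection_apply]
  congr 2
  ext
  · simp [rightWell, leftWell]
    ring
  · simp [rightWell, leftWell]

theorem rightPotential_eq (L : ℝ) (β : ℝ → ℝ) (x : ℝ × ℝ) :
    rightPotential L β x
      = ((leftPotential L β (reflection x)).1, -(leftPotential L β (reflection x)).2) := by
  rw [rightPotential, leftPotential, radialPotential_eq, radialPotential_eq,
    radialFactor_rightField]
  ext
  · simp [rightWell, leftWell]
  · simp [rightWell, leftWell]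
    ring

/-! ### The one-well fields -/

theorem distSq_nonneg (p x : ℝ × ℝ) : 0 ≤ distSq p x := by
  unfold distSq; positivity

theorem contDiff_distSq (p : ℝ × ℝ) {n : WithTop ℕ∞} : ContDiff ℝ n (distSq p) := by
  unfold distSq; fun_prop

/-- The scalar factor of the left potential. -/
noncomputable def leftFactor (L : ℝ) (β : ℝ → ℝ) : ℝ × ℝ → ℝ :=
  radialFactor (leftField L β) (leftWell L)

theorem leftPotential_eq (L : ℝ) (β : ℝ → ℝ) (x : ℝ × ℝ) :
    leftPotential L β x = (-(leftFactor L β x * x.2), leftFactor L β x * (x.1 + L / 2)) := by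
  rw [leftPotential, radialPotential_eq]
  simp [leftFactor, leftWell]

theorem leftFactor_eq (L : ℝ) (β : ℝ → ℝ) (x : ℝ × ℝ) :
    leftFactor L β x = ∫ t in (0 : ℝ)..1, β (t ^ 2 * (distSq (leftWell L) x / 2)) * t := by
  unfold leftFactor radialFactor
  refine intervalIntegral.integral_congr fun t _ => ?_
  simp only [leftField]
  congr 2
  simp [distSq]
  ring

theorem leftFactor_congr {L : ℝ} {β : ℝ → ℝ} {x y : ℝ × ℝ}
    (h : distSq (leftWell L) x = distSq (leftWell L) y) : leftFactor L β x = leftFactor L β y := by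
  rw [leftFactor_eq, leftFactor_eq, h]

section Profile

variable {a L b₀ b₁ : ℝ} {β : ℝ → ℝ}

theorem IsProfile.continuousOn (hβ : IsProfile a b₀ b₁ β) : ContinuousOn β (Ici 0) :=
  hβ.smooth.continuousOn

theorem IsProfile.bottom_le (hβ : IsProfile a b₀ b₁ β) {u : ℝ} (hu : 0 ≤ u) : b₀ ≤ β u := by
  rcases hu.eq_or_lt with rfl | h
  · exact hβ.value_zero.ge
  · exact (hβ.unique_min u h).le

theorem contDiff_leftField (hβ : IsProfile a b₀ b₁ β) (L : ℝ) :
    ContDiff ℝ ∞ (leftField L β) := by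
  have h : ContDiff ℝ ∞ fun x => distSq (leftWell L) x / 2 := (contDiff_distSq _).div_const 2
  exact hβ.smooth.comp_contDiff h fun x => div_nonneg (distSq_nonneg _ _) two_pos.le

theorem contDiff_rightField (hβ : IsProfile a b₀ b₁ β) (L : ℝ) :
    ContDiff ℝ ∞ (rightField L β) :=
  (contDiff_leftField hβ L).comp reflection.contDiff

theorem contDiff_leftFactor (hβ : IsProfile a b₀ b₁ β) (L : ℝ) :
    ContDiff ℝ 1 (leftFactor L β) :=
  contDiff_radialFactor ((contDiff_leftField hβ L).of_le (by norm_cast)) _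

theorem contDiff_leftPotential (hβ : IsProfile a b₀ b₁ β) (L : ℝ) :
    ContDiff ℝ 1 (leftPotential L β) :=
  contDiff_radialPotential ((contDiff_leftField hβ L).of_le (by norm_cast)) _

theorem contDiff_rightPotential (hβ : IsProfile a b₀ b₁ β) (L : ℝ) :
    ContDiff ℝ 1 (rightPotential L β) :=
  contDiff_radialPotential ((contDiff_rightField hβ L).of_le (by norm_cast)) _

theorem curl_leftPotential (hβ : IsProfile a b₀ b₁ β) (L : ℝ) (x : ℝ × ℝ) :
    curl (leftPotential L β) x = leftField L β x :=
  curl_radialPotential ((contDiff_leftField hβ L).of_le (by norm_cast)) _ x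

theorem curl_rightPotential (hβ : IsProfile a b₀ b₁ β) (L : ℝ) (x : ℝ × ℝ) :
    curl (rightPotential L β) x = rightField L β x :=
  curl_radialPotential ((contDiff_rightField hβ L).of_le (by norm_cast)) _ x

theorem continuousOn_profile_comp (hβ : IsProfile a b₀ b₁ β) {f : ℝ → ℝ} (hf : Continuous f)
    (hf0 : ∀ t, 0 ≤ f t) : Continuous fun t => β (f t) :=
  hβ.continuousOn.comp_continuous hf hf0

/-- The lower bound makes `A_ℓ` nonzero away from the well bottom, which forces radial groundstates,
and makes `|A_ℓ|²` confining. The upper bound limits `A_ℓ` to linear growth. -/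
theorem leftFactor_bounds (hβ : IsProfile a b₀ b₁ β) (L : ℝ) (x : ℝ × ℝ) :
    b₀ / 2 ≤ leftFactor L β x ∧ leftFactor L β x ≤ b₁ / 2 := by
  have hq := distSq_nonneg (leftWell L) x
  have hc : Continuous fun t : ℝ => β (t ^ 2 * (distSq (leftWell L) x / 2)) * t :=
    (continuousOn_profile_comp hβ (by fun_prop) fun t => by positivity).mul continuous_id
  have hI : ∀ b : ℝ, ∫ t in (0 : ℝ)..1, b * t = b / 2 := fun b => by
    rw [intervalIntegral.integral_const_mul, integral_id]; ring
  rw [leftFactor_eq]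
  constructor
  · rw [← hI b₀]
    refine intervalIntegral.integral_mono_on zero_le_one
      (Continuous.intervalIntegrable (by fun_prop) _ _) (hc.intervalIntegrable _ _) fun t ht => ?_
    exact mul_le_mul_of_nonneg_right (hβ.bottom_le (by positivity)) ht.1
  · rw [← hI b₁]
    refine intervalIntegral.integral_mono_on zero_le_one
      (hc.intervalIntegrable _ _) (Continuous.intervalIntegrable (by fun_prop) _ _) fun t ht => ?_
    exact mul_le_mul_of_nonneg_right (hβ.le_top _ (by positivity)) ht.1

theorem IsProfile.intervalIntegrable (hβ : IsProfile a b₀ b₁ β) {u v : ℝ} (hu : 0 ≤ u)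
    (hv : 0 ≤ v) : IntervalIntegrable β volume u v :=
  (hβ.continuousOn.mono fun _ hx => (le_inf hu hv).trans hx.1).intervalIntegrable

/-- Stokes on a disc, divided by `2π`: the substitution `u = t² q / 2` with `q` the squared
distance. -/
theorem distSq_mul_leftFactor (hβ : IsProfile a b₀ b₁ β) (L : ℝ) (x : ℝ × ℝ) :
    distSq (leftWell L) x * leftFactor L β x = ∫ u in (0 : ℝ)..distSq (leftWell L) x / 2, β u := by
  set q := distSq (leftWell L) x with hq'
  have hq : 0 ≤ q := distSq_nonneg _ _
  have := intervalIntegral.integral_comp_mul_deriv'' (a := 0) (b := 1)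
    (f := fun t => t ^ 2 * (q / 2)) (f' := fun t => t * q) (g := β)
    (by fun_prop) (fun t _ => by
      have := ((hasDerivAt_pow 2 t).mul_const (q / 2)).hasDerivWithinAt (s := Ioi t)
      convert! this using 1
      push_cast
      ring) (by fun_prop)
    (hβ.continuousOn.mono (by
      rintro _ ⟨t, _, rfl⟩
      exact mem_Ici.2 (by positivity)))
  simp only [Function.comp_def, one_pow, one_mul, ne_eq, OfNat.ofNat_ne_zero, not_false_eq_true,
    zero_pow, zero_mul] at this
  rw [← this, leftFactor_eq, ← intervalIntegral.integral_const_mul]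
  refine intervalIntegral.integral_congr fun t _ => ?_
  simp only [← hq']
  ring

theorem integral_profile_of_le (hβ : IsProfile a b₀ b₁ β) {u : ℝ} (hu : a ^ 2 / 2 ≤ u) :
    ∫ s in (0 : ℝ)..u, β s = b₁ * u + ∫ s in (0 : ℝ)..a ^ 2 / 2, (β s - b₁) := by
  have h0 : 0 ≤ a ^ 2 / 2 := by positivity
  rw [← intervalIntegral.integral_add_adjacent_intervals (hβ.intervalIntegrable le_rfl h0)
    (hβ.intervalIntegrable h0 (h0.trans hu)),
    intervalIntegral.integral_sub (hβ.intervalIntegrable le_rfl h0) (by simp),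
    intervalIntegral.integral_const]
  have : ∫ s in (a ^ 2 / 2)..u, β s = ∫ s in (a ^ 2 / 2)..u, b₁ := by
    refine intervalIntegral.integral_congr_ae (.of_forall fun s hs => ?_)
    rw [uIoc_of_le hu] at hs
    exact hβ.eq_top s hs.1
  rw [this, intervalIntegral.integral_const]
  simp only [smul_eq_mul]
  ring

/-- This half-plane misses the right disc, and outside the left disc both fields are `b₁`. -/
theorem doubleField_eq_leftField (hβ : IsProfile a b₀ b₁ β) (ha : 0 < a)
    {x : ℝ × ℝ} (hx : x.1 < L / 2 - a) : doubleField a L b₁ β x = leftField L β x := by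
  unfold doubleField
  split_ifs with h1 h2
  · rfl
  · exfalso
    simp only [distSq, rightWell] at h2
    nlinarith [sq_nonneg (x.2 - 0)]
  · exact (hβ.eq_top _ (by linarith)).symm

theorem doubleField_eq_rightField (hβ : IsProfile a b₀ b₁ β) (ha : 0 < a)
    {x : ℝ × ℝ} (hx : -(L / 2 - a) < x.1) : doubleField a L b₁ β x = rightField L β x := by
  unfold doubleField
  split_ifs with h1 h2
  · exfalso
    simp only [distSq, leftWell] at h1
    nlinarith [sq_nonneg (x.2 - 0)]
  · rfl
  · rw [rightField_eq, leftField, distSq_leftWell_reflection]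
    exact (hβ.eq_top _ (by linarith)).symm

/-! ### The flux of one well and the exterior form of its potential. -/

theorem integrable_leftField_sub (hβ : IsProfile a b₀ b₁ β) (ha : 0 < a) (L : ℝ) :
    Integrable (fun x => leftField L β x - b₁) := by
  refine ((contDiff_leftField hβ L).continuous.sub continuous_const).integrable_of_hasCompactSupport
    (HasCompactSupport.intro (K := Icc (-(L / 2) - a) (-(L / 2) + a) ×ˢ Icc (-a) a)
      (isCompact_Icc.prod isCompact_Icc) fun x hx => ?_)
  rw [Pi.sub_apply, sub_eq_zero]
  refine hβ.eq_top _ ?_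
  by_contra! hcon
  refine hx ?_
  simp only [distSq, leftWell] at hcon
  have h1 : (x.1 + L / 2) ^ 2 ≤ a ^ 2 := by nlinarith [sq_nonneg (x.2 - 0)]
  have h2 : x.2 ^ 2 ≤ a ^ 2 := by nlinarith [sq_nonneg (x.1 - -(L / 2))]
  have h1' := abs_le_of_sq_le_sq' h1 ha.le
  have h2' := abs_le_of_sq_le_sq' h2 ha.le
  exact ⟨⟨by linarith [h1'.1], by linarith [h1'.2]⟩, h2'⟩

theorem integral_leftField_sub (hβ : IsProfile a b₀ b₁ β) (ha : 0 < a) (L : ℝ) :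
    ∫ x, (leftField L β x - b₁) = 2 * Real.pi * ∫ s in (0 : ℝ)..a ^ 2 / 2, (β s - b₁) := by
  have hshift : ∫ x, (leftField L β x - b₁) = ∫ v : ℝ × ℝ, (β ((v.1 ^ 2 + v.2 ^ 2) / 2) - b₁) :=
    integral_sub_right_eq_self (fun v : ℝ × ℝ => β ((v.1 ^ 2 + v.2 ^ 2) / 2) - b₁) (leftWell L)
  have hr : ∫ r in Ioi (0 : ℝ), r * (β (r ^ 2 / 2) - b₁)
      = ∫ s in (0 : ℝ)..a ^ 2 / 2, (β s - b₁) := by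
    have h1 : ∫ r in Ioi (0 : ℝ), r * (β (r ^ 2 / 2) - b₁)
        = ∫ r in Ioc 0 a, r * (β (r ^ 2 / 2) - b₁) := by
      refine setIntegral_eq_of_subset_of_forall_sdiff_eq_zero measurableSet_Ioi
        Ioc_subset_Ioi_self fun r hr => ?_
      have h0 : 0 < r := hr.1
      have har : a < r := by
        by_contra! hle
        exact hr.2 ⟨h0, hle⟩
      rw [hβ.eq_top _ (by nlinarith), sub_self, mul_zero]
    rw [h1, ← intervalIntegral.integral_of_le ha.le]
    have := intervalIntegral.integral_comp_mul_deriv'' (a := 0) (b := a)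
      (f := fun r => r ^ 2 / 2) (f' := fun r => r) (g := fun s => β s - b₁)
      (by fun_prop) (fun t _ => by
        have := ((hasDerivAt_pow 2 t).div_const 2).hasDerivWithinAt (s := Ioi t)
        convert! this using 1
        push_cast
        ring) (by fun_prop)
      ((hβ.continuousOn.mono (by
        rintro _ ⟨t, _, rfl⟩
        exact mem_Ici.2 (by positivity))).sub continuousOn_const)
    simp only [Function.comp_def, ne_eq, OfNat.ofNat_ne_zero, not_false_eq_true, zero_pow,
      zero_div] at this
    rw [← this]
    simp only [mul_comm]
  rw [hshift, ← integral_comp_polarCoord_symm]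
  have hpolar : ∀ z : ℝ × ℝ, z.1 • (β (((polarCoord.symm z).1 ^ 2
      + (polarCoord.symm z).2 ^ 2) / 2) - b₁) = (z.1 * (β (z.1 ^ 2 / 2) - b₁)) * 1 := fun z => by
    have : (polarCoord.symm z).1 ^ 2 + (polarCoord.symm z).2 ^ 2 = z.1 ^ 2 := by
      simp only [polarCoord_symm_apply]
      linear_combination z.1 ^ 2 * Real.cos_sq_add_sin_sq z.2
    rw [this, smul_eq_mul, mul_one]
  simp only [hpolar]
  rw [polarCoord_target, Measure.volume_eq_prod, setIntegral_prod_mul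
    (fun r : ℝ => r * (β (r ^ 2 / 2) - b₁)) (fun _ : ℝ => (1 : ℝ)), hr]
  have hpi : ∫ _ in Ioo (-Real.pi) Real.pi, (1 : ℝ) = 2 * Real.pi := by
    simp [Real.pi_pos.le]
    ring
  rw [hpi]
  ring

/-- The discs are disjoint, so `B - b₁` is the sum of two mirror-image perturbations, each of
integral `2π` times the right side; the prefactor `1 / (4π)` cancels exactly. -/
theorem fluxDifference_eq (hβ : IsProfile a b₀ b₁ β) (ha : 0 < a) (haL : a < L / 2) :
    fluxDifference a L b₁ β = ∫ s in (0 : ℝ)..a ^ 2 / 2, (β s - b₁) := by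
  have hsplit : ∀ x, doubleField a L b₁ β x - b₁
      = (leftField L β x - b₁) + (leftField L β (reflection x) - b₁) := fun x => by
    rw [← rightField_eq]
    rcases lt_or_ge x.1 (L / 2 - a) with hx | hx
    · rw [doubleField_eq_leftField hβ ha hx]
      have : rightField L β x = b₁ := by
        rw [rightField_eq, leftField, distSq_leftWell_reflection]
        refine hβ.eq_top _ ?_
        simp only [distSq, rightWell]
        nlinarith [sq_nonneg (x.2 - 0)]
      rw [this]; ring
    · rw [doubleField_eq_rightField hβ ha (by linarith)]
      have : leftField L β x = b₁ := by
        refine hβ.eq_top _ ?_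
        simp only [distSq, leftWell]
        nlinarith [sq_nonneg (x.2 - 0)]
      rw [this]; ring
  have hi := integrable_leftField_sub hβ ha L
  have hi' : Integrable fun x => leftField L β (reflection x) - b₁ :=
    measurePreserving_reflection.integrable_comp_of_integrable hi
  rw [fluxDifference]
  simp only [hsplit]
  rw [integral_add hi hi', integral_comp_reflection fun x => leftField L β x - b₁,
    integral_leftField_sub hβ ha L]
  field_simp
  ring

/-- Outside the disc the flux is that of the constant field plus a fixed defect, so the correction
to the constant-field potential is of Aharonov–Bohm type. -/
theorem leftFactor_of_le_distSq (hβ : IsProfile a b₀ b₁ β) (ha : 0 < a) (haL : a < L / 2)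
    {x : ℝ × ℝ} (hx : a ^ 2 ≤ distSq (leftWell L) x) :
    leftFactor L β x = b₁ / 2 + fluxDifference a L b₁ β / distSq (leftWell L) x := by
  have hq : 0 < distSq (leftWell L) x := (by positivity : 0 < a ^ 2).trans_le hx
  have h := distSq_mul_leftFactor hβ L x
  rw [integral_profile_of_le hβ (by linarith), ← fluxDifference_eq hβ ha haL] at h
  field_simp
  linear_combination 2 * h

end Profile

/-! ### The gauge functions on the symmetry line -/

theorem curl_sub {F G : ℝ × ℝ → ℝ × ℝ} {x : ℝ × ℝ} (hF : DifferentiableAt ℝ F x)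
    (hG : DifferentiableAt ℝ G x) : curl (fun y => F y - G y) x = curl F x - curl G x := by
  unfold curl partial₁ partial₂
  simp only [Prod.fst_sub, Prod.snd_sub]
  rw [fderiv_fun_sub hF.snd hG.snd, fderiv_fun_sub hF.fst hG.fst]
  simp only [sub_apply]
  ring

section Gauge

variable {a L b₀ b₁ : ℝ} {β : ℝ → ℝ} {A : ℝ × ℝ → ℝ × ℝ}

theorem contDiff_sigmaLeft (hβ : IsProfile a b₀ b₁ β) (L : ℝ) (hA : ContDiff ℝ 1 A) :
    ContDiff ℝ 1 (sigmaLeft L β A) :=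
  contDiff_segmentIntegral (hA.sub (contDiff_leftPotential hβ L))

theorem contDiff_sigmaRight (hβ : IsProfile a b₀ b₁ β) (L : ℝ) (hA : ContDiff ℝ 1 A) :
    ContDiff ℝ 1 (sigmaRight L β A) :=
  contDiff_segmentIntegral (hA.sub (contDiff_rightPotential hβ L))

/-- The half-plane contains the origin, hence the whole segment `[0, x]`, along which `A - A_ℓ` is
curl free. -/
theorem fderiv_sigmaLeft (hβ : IsProfile a b₀ b₁ β) (ha : 0 < a) (haL : a < L / 2)
    (hA : ContDiff ℝ 1 A) (hAB : ∀ x, curl A x = doubleField a L b₁ β x) {x : ℝ × ℝ}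
    (hx : x.1 < L / 2 - a) (v : ℝ × ℝ) :
    fderiv ℝ (sigmaLeft L β A) x v
      = ((A x).1 - (leftPotential L β x).1) * v.1 + ((A x).2 - (leftPotential L β x).2) * v.2 := by
  have hA' := contDiff_leftPotential hβ L
  refine fderiv_segmentIntegral (hA.sub hA') (fun t ht => ?_) v
  rw [curl_sub (hA.differentiable one_ne_zero _) (hA'.differentiable one_ne_zero _), hAB,
    curl_leftPotential hβ, doubleField_eq_leftField hβ ha, sub_self]
  change t * x.1 < L / 2 - a
  rcases le_total 0 x.1 with h | h
  · nlinarith [ht.2]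
  · nlinarith [ht.1]

theorem fderiv_sigmaRight (hβ : IsProfile a b₀ b₁ β) (ha : 0 < a) (haL : a < L / 2)
    (hA : ContDiff ℝ 1 A) (hAB : ∀ x, curl A x = doubleField a L b₁ β x) {x : ℝ × ℝ}
    (hx : -(L / 2 - a) < x.1) (v : ℝ × ℝ) :
    fderiv ℝ (sigmaRight L β A) x v
      = ((A x).1 - (rightPotential L β x).1) * v.1
        + ((A x).2 - (rightPotential L β x).2) * v.2 := by
  have hA' := contDiff_rightPotential hβ L
  refine fderiv_segmentIntegral (hA.sub hA') (fun t ht => ?_) v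
  rw [curl_sub (hA.differentiable one_ne_zero _) (hA'.differentiable one_ne_zero _), hAB,
    curl_rightPotential hβ, doubleField_eq_rightField hβ ha, sub_self]
  change -(L / 2 - a) < t * x.1
  rcases le_total 0 x.1 with h | h
  · nlinarith [ht.1]
  · nlinarith [ht.2]

theorem theta_eq_segmentIntegral (hβ : IsProfile a b₀ b₁ β) (L : ℝ) (hA : ContDiff ℝ 1 A)
    (x : ℝ × ℝ) :
    theta L β A x
      = segmentIntegral (fun y => leftPotential L β y - rightPotential L β y) x := by
  have hl := (contDiff_leftPotential hβ L).continuous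
  have hr := (contDiff_rightPotential hβ L).continuous
  rw [theta, sigmaRight, sigmaLeft, segmentIntegral_sub hA.continuous hr,
    segmentIntegral_sub hA.continuous hl, segmentIntegral_sub hl hr]
  ring

theorem leftFactor_symmetryLine (hβ : IsProfile a b₀ b₁ β) (ha : 0 < a) (haL : a < L / 2)
    (y : ℝ) :
    leftFactor L β (0, y) = b₁ / 2 + fluxDifference a L b₁ β / (L ^ 2 / 4 + y ^ 2) := by
  have hq : distSq (leftWell L) (0, y) = L ^ 2 / 4 + y ^ 2 := by
    simp only [distSq, leftWell]
    ring
  rw [leftFactor_of_le_distSq hβ ha haL, hq]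
  rw [hq]
  nlinarith [sq_nonneg y]

theorem theta_symmetryLine (hβ : IsProfile a b₀ b₁ β) (ha : 0 < a) (haL : a < L / 2)
    (hA : ContDiff ℝ 1 A) (y : ℝ) :
    theta L β A (0, y)
      = b₁ * L * y / 2 + 2 * fluxDifference a L b₁ β * Real.arctan (2 * y / L) := by
  have hL : 0 < L := by linarith
  set M := fluxDifference a L b₁ β with hM
  rw [theta_eq_segmentIntegral hβ L hA, segmentIntegral]
  have hint : ∀ t : ℝ, ((leftPotential L β (t • ((0 : ℝ), y))
        - rightPotential L β (t • ((0 : ℝ), y))).1 * ((0 : ℝ), y).1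
      + (leftPotential L β (t • ((0 : ℝ), y)) - rightPotential L β (t • ((0 : ℝ), y))).2
        * ((0 : ℝ), y).2)
      = L * (b₁ / 2 + M / (L ^ 2 / 4 + (t * y) ^ 2)) * y := fun t => by
    have : t • ((0 : ℝ), y) = (0, t * y) := by simp
    rw [this, rightPotential_eq]
    simp only [reflection_apply, neg_zero, leftPotential_eq, Prod.snd_sub,
      leftFactor_symmetryLine hβ ha haL, ← hM]
    ring
  simp only [hint]
  have hpos : ∀ t : ℝ, 0 < L ^ 2 / 4 + (t * y) ^ 2 := fun t => by positivity
  -- On the symmetry line the second components of `A_ℓ` and `A_r` are opposite, so the integrand is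
  -- `L y` times the radial factor; this is its antiderivative.
  have hg : ∀ t : ℝ, HasDerivAt
      (fun t => b₁ * L * y / 2 * t + 2 * M * Real.arctan (2 * y / L * t))
      (L * (b₁ / 2 + M / (L ^ 2 / 4 + (t * y) ^ 2)) * y) t := fun t => by
    have h1 := (hasDerivAt_id t).const_mul (b₁ * L * y / 2)
    have h2 := ((((hasDerivAt_id t).const_mul (2 * y / L)).arctan).const_mul (2 * M))
    convert! h1.add h2 using 1
    have h3 : 1 + (2 * y / L * t) ^ 2 ≠ 0 := by positivity
    have h4 := (hpos t).ne'
    simp only [id, mul_one]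
    field_simp
    ring
  have hcont : Continuous fun t : ℝ => L * (b₁ / 2 + M / (L ^ 2 / 4 + (t * y) ^ 2)) * y := by
    have : Continuous fun t : ℝ => M / (L ^ 2 / 4 + (t * y) ^ 2) :=
      continuous_const.div (by fun_prop) fun t => (hpos t).ne'
    fun_prop
  rw [intervalIntegral.integral_eq_sub_of_hasDerivAt (fun t _ => hg t)
    (hcont.intervalIntegrable _ _)]
  simp

theorem kCoeff_eq_potentials (hβ : IsProfile a b₀ b₁ β) (ha : 0 < a) (haL : a < L / 2)
    (hA : ContDiff ℝ 1 A) (hA₁ : ∀ x, (A x).1 = 0)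
    (hAB : ∀ x, curl A x = doubleField a L b₁ β x) (y : ℝ) :
    kCoeff L β A (0, y) = -((leftPotential L β (0, y)).1 + (rightPotential L β (0, y)).1) := by
  rw [kCoeff, partial₁, partial₁,
    fderiv_sigmaLeft hβ ha haL hA hAB (show (0 : ℝ) < L / 2 - a by linarith),
    fderiv_sigmaRight hβ ha haL hA hAB (show -(L / 2 - a) < (0 : ℝ) by linarith), hA₁]
  ring

theorem kCoeff_symmetryLine (hβ : IsProfile a b₀ b₁ β) (ha : 0 < a) (haL : a < L / 2)
    (hA : ContDiff ℝ 1 A) (hA₁ : ∀ x, (A x).1 = 0)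
    (hAB : ∀ x, curl A x = doubleField a L b₁ β x) (y : ℝ) :
    kCoeff L β A (0, y)
      = b₁ * y + 2 * fluxDifference a L b₁ β * y / (L ^ 2 / 4 + y ^ 2) := by
  rw [kCoeff_eq_potentials hβ ha haL hA hA₁ hAB, rightPotential_eq]
  simp only [reflection_apply, neg_zero, leftPotential_eq, leftFactor_symmetryLine hβ ha haL]
  ring

end Gauge

/-! ### Reflecting eigenfunctions -/

theorem fderiv_conj_reflection (u : ℝ × ℝ → ℂ) (x v : ℝ × ℝ) :
    fderiv ℝ (fun y => (starRingEnd ℂ) (u (reflection y))) x v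
      = (starRingEnd ℂ) (fderiv ℝ u (reflection x) (reflection v)) := by
  have h1 : fderiv ℝ (Complex.conjCLE ∘ (u ∘ reflection)) x
      = (Complex.conjCLE : ℂ →L[ℝ] ℂ).comp (fderiv ℝ (u ∘ reflection) x) :=
    Complex.conjCLE.comp_fderiv
  rw [reflection.comp_right_fderiv] at h1
  exact congrArg (fun l : ℝ × ℝ →L[ℝ] ℂ => l v) h1

theorem momentum₁_conj_reflection {A A' : ℝ × ℝ → ℝ × ℝ}
    (hA : ∀ x, A' x = ((A (reflection x)).1, -(A (reflection x)).2)) (h : ℝ)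
    (u : ℝ × ℝ → ℂ) :
    momentum₁ h A' (fun y => (starRingEnd ℂ) (u (reflection y)))
      = fun y => (starRingEnd ℂ) (momentum₁ h A u (reflection y)) := by
  funext x
  have : reflection ((1 : ℝ), (0 : ℝ)) = -((1 : ℝ), (0 : ℝ)) := by ext <;> simp
  rw [momentum₁, momentum₁, partial₁, partial₁, fderiv_conj_reflection, this, hA, map_neg]
  simp only [map_sub, map_mul, map_neg, Complex.conj_I, Complex.conj_ofReal]
  ring

theorem momentum₂_conj_reflection {A A' : ℝ × ℝ → ℝ × ℝ}
    (hA : ∀ x, A' x = ((A (reflection x)).1, -(A (reflection x)).2)) (h : ℝ)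
    (u : ℝ × ℝ → ℂ) :
    momentum₂ h A' (fun y => (starRingEnd ℂ) (u (reflection y)))
      = fun y => -(starRingEnd ℂ) (momentum₂ h A u (reflection y)) := by
  funext x
  have : reflection ((0 : ℝ), (1 : ℝ)) = ((0 : ℝ), (1 : ℝ)) := by ext <;> simp
  rw [momentum₂, momentum₂, partial₂, partial₂, fderiv_conj_reflection, this, hA]
  simp only [map_sub, map_mul, map_neg, Complex.conj_I, Complex.conj_ofReal, Complex.ofReal_neg]
  ring

theorem momentum₂_neg (h : ℝ) (A : ℝ × ℝ → ℝ × ℝ) (u : ℝ × ℝ → ℂ) :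
    momentum₂ h A (fun y => -u y) = fun y => -momentum₂ h A u y := by
  funext x
  rw [momentum₂, momentum₂, partial₂, partial₂, fderiv_fun_neg, neg_apply]
  ring

/-- Reflection reverses the sign of the magnetic field and complex conjugation reverses it back. The
first momentum is intertwined with sign `+`, the second with sign `-`, and the latter disappears on
squaring. -/
theorem magneticLaplacian_conj_reflection {A A' : ℝ × ℝ → ℝ × ℝ}
    (hA : ∀ x, A' x = ((A (reflection x)).1, -(A (reflection x)).2)) (h : ℝ)
    (u : ℝ × ℝ → ℂ) (x : ℝ × ℝ) :
    magneticLaplacian h A' (fun y => (starRingEnd ℂ) (u (reflection y))) x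
      = (starRingEnd ℂ) (magneticLaplacian h A u (reflection x)) := by
  rw [magneticLaplacian, momentum₁_conj_reflection hA, momentum₁_conj_reflection hA,
    momentum₂_conj_reflection hA, momentum₂_neg, momentum₂_conj_reflection hA, magneticLaplacian]
  simp

theorem eigenvalues_subset_of_reflection {A A' : ℝ × ℝ → ℝ × ℝ}
    (hA : ∀ x, A' x = ((A (reflection x)).1, -(A (reflection x)).2)) (h : ℝ) :
    eigenvalues h A ⊆ eigenvalues h A' := by
  rintro μ ⟨u, hu, hL2, hne, heq⟩
  refine ⟨fun y => (starRingEnd ℂ) (u (reflection y)),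
    Complex.conjCLE.contDiff.comp (hu.comp reflection.contDiff), ?_, ?_, fun x => ?_⟩
  · have h1 : MemLp (u ∘ reflection) 2 volume :=
      hL2.comp_measurePreserving measurePreserving_reflection
    exact h1.star
  · contrapose! hne
    funext x
    have := congrFun hne (reflection x)
    simpa using this
  · rw [magneticLaplacian_conj_reflection hA, heq]
    simp

theorem eigenvalues_reflection {A A' : ℝ × ℝ → ℝ × ℝ}
    (hA : ∀ x, A' x = ((A (reflection x)).1, -(A (reflection x)).2)) (h : ℝ) :
    eigenvalues h A' = eigenvalues h A := by
  refine (eigenvalues_subset_of_reflection (fun x => ?_) h).antisymm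
    (eigenvalues_subset_of_reflection hA h)
  rw [hA, reflection_reflection]
  simp

theorem IsPositiveGroundstate.reflect {A A' : ℝ × ℝ → ℝ × ℝ} {h μ : ℝ} {φ : ℝ × ℝ → ℝ}
    (hA : ∀ x, A' x = ((A (reflection x)).1, -(A (reflection x)).2))
    (hφ : IsPositiveGroundstate h A μ φ) :
    IsPositiveGroundstate h A' μ (fun x => φ (reflection x)) where
  least := by rw [eigenvalues_reflection hA]; exact hφ.least
  smooth := hφ.smooth.comp reflection.contDiff
  pos x := hφ.pos _
  normalized := by
    rw [integral_comp_reflection fun x => φ x ^ 2]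
    exact hφ.normalized
  equation x := by
    have := magneticLaplacian_conj_reflection hA h (fun y => (φ y : ℂ)) x
    simp only [Complex.conj_ofReal] at this
    rw [this, hφ.equation]
    simp

theorem leftPotential_eq_reflection (L : ℝ) (β : ℝ → ℝ) (x : ℝ × ℝ) :
    leftPotential L β x
      = ((rightPotential L β (reflection x)).1, -(rightPotential L β (reflection x)).2) := by
  rw [rightPotential_eq, reflection_reflection]
  simp

/-! ### Directional momenta -/

/-- The component of `-ih∇ - A` in the direction `v`, with `α = A · v`. -/
noncomputable def momentum (h : ℝ) (v : ℝ × ℝ) (α : ℝ × ℝ → ℝ) (u : ℝ × ℝ → ℂ)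
    (x : ℝ × ℝ) : ℂ :=
  -Complex.I * h * fderiv ℝ u x v - (α x : ℂ) * u x

theorem momentum₁_eq (h : ℝ) (A : ℝ × ℝ → ℝ × ℝ) :
    momentum₁ h A = momentum h (1, 0) (fun y => (A y).1) := rfl

theorem momentum₂_eq (h : ℝ) (A : ℝ × ℝ → ℝ × ℝ) :
    momentum₂ h A = momentum h (0, 1) (fun y => (A y).2) := rfl

theorem fderiv_ofReal {φ : ℝ × ℝ → ℝ} {x : ℝ × ℝ} (hφ : DifferentiableAt ℝ φ x) (v : ℝ × ℝ) :
    fderiv ℝ (fun y => (φ y : ℂ)) x v = (fderiv ℝ φ x v : ℂ) := by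
  have := (Complex.ofRealCLM.hasFDerivAt.comp x hφ.hasFDerivAt).fderiv
  exact congrArg (fun l : ℝ × ℝ →L[ℝ] ℂ => l v) this

theorem contDiff_fderiv_apply {E : Type*} [NormedAddCommGroup E] [NormedSpace ℝ E]
    {f : ℝ × ℝ → E} (hf : ContDiff ℝ ∞ f) (v : ℝ × ℝ) :
    ContDiff ℝ ∞ (fun y => fderiv ℝ f y v) :=
  (hf.fderiv_right (m := ∞) le_rfl).clm_apply contDiff_const

theorem momentum_ofReal {φ : ℝ × ℝ → ℝ} (hφ : ContDiff ℝ ∞ φ) (h : ℝ) (v : ℝ × ℝ)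
    (α : ℝ × ℝ → ℝ) (x : ℝ × ℝ) :
    momentum h v α (fun y => (φ y : ℂ)) x
      = -Complex.I * h * (fderiv ℝ φ x v : ℂ) - (α x : ℂ) * φ x := by
  rw [momentum, fderiv_ofReal (hφ.differentiable (by simp) x)]

theorem momentum_momentum_ofReal {φ α : ℝ × ℝ → ℝ} (hφ : ContDiff ℝ ∞ φ) (h : ℝ) (v : ℝ × ℝ)
    {x : ℝ × ℝ} (hα : DifferentiableAt ℝ α x) :
    momentum h v α (momentum h v α fun y => (φ y : ℂ)) x
      = ((-h ^ 2 * fderiv ℝ (fun y => fderiv ℝ φ y v) x v + α x ^ 2 * φ x : ℝ) : ℂ)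
        + Complex.I * ((h * (fderiv ℝ α x v * φ x + 2 * (α x * fderiv ℝ φ x v)) : ℝ) : ℂ) := by
  have hd : DifferentiableAt ℝ (fun y => fderiv ℝ φ y v) x :=
    (contDiff_fderiv_apply hφ v).differentiable (by simp) x
  have hφd := hφ.differentiable (by simp) x
  have e : (momentum h v α fun y => (φ y : ℂ))
      = fun y => -Complex.I * h * (fderiv ℝ φ y v : ℂ) - ((α y * φ y : ℝ) : ℂ) := by
    funext y
    rw [momentum_ofReal hφ]
    push_cast
    ring
  have hd' : HasFDerivAt (fun y => ((fderiv ℝ φ y v : ℝ) : ℂ)) _ x :=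
    Complex.ofRealCLM.hasFDerivAt.comp x hd.hasFDerivAt
  have hp' : HasFDerivAt (fun y => ((α y * φ y : ℝ) : ℂ)) _ x :=
    Complex.ofRealCLM.hasFDerivAt.comp x (hα.hasFDerivAt.mul hφd.hasFDerivAt)
  have hfd : fderiv ℝ (fun y => -Complex.I * h * (fderiv ℝ φ y v : ℂ) - ((α y * φ y : ℝ) : ℂ)) x
      = _ := ((hd'.const_mul (-Complex.I * h)).sub hp').fderiv
  rw [e, momentum, hfd]
  simp only [sub_apply, smul_apply, ContinuousLinearMap.comp_apply, add_apply,
    Complex.ofRealCLM_apply, smul_eq_mul]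
  push_cast
  linear_combination (h ^ 2 * (fderiv ℝ (fun y => fderiv ℝ φ y v) x v : ℂ)) * Complex.I_sq

/-- For a real function the operator splits into a real Schrödinger part with potential `|A|²` and
an imaginary transport part, so a real eigenfunction satisfies two equations. -/
theorem magneticLaplacian_ofReal {φ : ℝ × ℝ → ℝ} (hφ : ContDiff ℝ ∞ φ) (h : ℝ)
    {A : ℝ × ℝ → ℝ × ℝ} {x : ℝ × ℝ} (hA : DifferentiableAt ℝ A x) :
    magneticLaplacian h A (fun y => (φ y : ℂ)) x
      = ((-h ^ 2 * (partial₁ (partial₁ φ) x + partial₂ (partial₂ φ) x)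
          + ((A x).1 ^ 2 + (A x).2 ^ 2) * φ x : ℝ) : ℂ)
        + Complex.I * ((h * ((partial₁ (fun y => (A y).1) x + partial₂ (fun y => (A y).2) x) * φ x
          + 2 * ((A x).1 * partial₁ φ x + (A x).2 * partial₂ φ x)) : ℝ) : ℂ) := by
  have e₁ : partial₁ φ = fun y => fderiv ℝ φ y (1, 0) := rfl
  have e₂ : partial₂ φ = fun y => fderiv ℝ φ y (0, 1) := rfl
  rw [magneticLaplacian, momentum₁_eq, momentum₂_eq, momentum_momentum_ofReal hφ h _ hA.fst,
    momentum_momentum_ofReal hφ h _ hA.snd, e₁, e₂]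
  simp only [partial₁, partial₂]
  push_cast
  ring

/-! ### The radial ordinary differential equation -/

/-- The Wronskian times `r` is constant and vanishes at `r = 0`; this selects the solutions regular
at the origin, and a vanishing Wronskian makes the quotient constant. -/
theorem eq_const_mul_of_radial_ode {W f₁ g₁ f₂ g₂ : ℝ → ℝ}
    (hf₁ : ∀ r, HasDerivAt f₁ (g₁ r) r) (hg₁ : ∀ r, HasDerivAt (fun r => r * g₁ r) (r * W r * f₁ r) r)
    (hf₂ : ∀ r, HasDerivAt f₂ (g₂ r) r) (hg₂ : ∀ r, HasDerivAt (fun r => r * g₂ r) (r * W r * f₂ r) r)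
    (hc₁ : Continuous g₁) (hc₂ : Continuous g₂) (hpos : ∀ r, f₂ r ≠ 0) (r : ℝ) :
    f₁ r = f₁ 0 / f₂ 0 * f₂ r := by
  have hcf₁ : Continuous f₁ := continuous_iff_continuousAt.2 fun r => (hf₁ r).continuousAt
  have hcf₂ : Continuous f₂ := continuous_iff_continuousAt.2 fun r => (hf₂ r).continuousAt
  have hwr : ∀ r, r * (g₁ r * f₂ r - f₁ r * g₂ r) = 0 := fun r => by
    have hd : ∀ s, HasDerivAt (fun s => (s * g₁ s) * f₂ s - f₁ s * (s * g₂ s)) 0 s := fun s => by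
      have := ((hg₁ s).mul (hf₂ s)).sub ((hf₁ s).mul (hg₂ s))
      convert! this using 1
      ring
    have := is_const_of_deriv_eq_zero (fun s => (hd s).differentiableAt) (fun s => (hd s).deriv) r 0
    simp only [zero_mul, mul_zero, sub_zero] at this
    linarith
  -- Cancelling `r` loses the point `0`, which continuity of the derivatives recovers.
  have hzero : (fun r => g₁ r * f₂ r - f₁ r * g₂ r) = fun _ => 0 :=
    Continuous.ext_on (dense_compl_singleton (0 : ℝ)) (by fun_prop) continuous_const
      fun s hs => (mul_eq_zero.1 (hwr s)).resolve_left hs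
  have hq : ∀ s, HasDerivAt (fun s => f₁ s / f₂ s) 0 s := fun s => by
    have := (hf₁ s).div (hf₂ s) (hpos s)
    convert! this using 1
    rw [congrFun hzero s, zero_div]
  have := is_const_of_deriv_eq_zero (fun s => (hq s).differentiableAt) (fun s => (hq s).deriv) r 0
  rw [← this, div_mul_cancel₀ _ (hpos r)]

/-- Beyond `R` the quantity `r * g r` increases. Were it ever positive, `f` would increase from
there on, against `hnot`; so it stays in `[-K, 0]`. A bounded quantity whose derivative dominates `c
r³ f` forces `f` to decay. -/
theorem radial_ode_decay {W f g : ℝ → ℝ} (hf : ∀ r, HasDerivAt f (g r) r)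
    (hg : ∀ r, HasDerivAt (fun r => r * g r) (r * W r * f r) r) (hpos : ∀ r, 0 < f r)
    {c R : ℝ} (hc : 0 < c) (hR : 1 ≤ R) (hW : ∀ r, R ≤ r → c * r ^ 2 ≤ W r)
    (hnot : ∀ ε > 0, ∀ r₀, ∃ r, r₀ ≤ r ∧ f r < ε) :
    ∃ C, ∀ r, 2 * R ≤ r → r ^ 4 * f r ≤ C ∧ r * |g r| ≤ C := by
  have hGmono : MonotoneOn (fun r => r * g r) (Ici R) := by
    refine monotoneOn_of_hasDerivWithinAt_nonneg (convex_Ici R)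
      (fun r _ => (hg r).continuousAt.continuousWithinAt)
      (fun r _ => (hg r).hasDerivWithinAt) fun r hr => ?_
    rw [interior_Ici] at hr
    have hr' : R < r := hr
    have := hW r hr'.le
    have hW0 : 0 ≤ W r := le_trans (by positivity) this
    have := (hpos r).le
    have : 0 ≤ r := by linarith
    positivity
  have hGneg : ∀ r, R ≤ r → r * g r ≤ 0 := by
    intro r₀ hr₀
    by_contra! hp
    have hfm : MonotoneOn f (Ici r₀) := by
      refine monotoneOn_of_hasDerivWithinAt_nonneg (convex_Ici r₀)
        (fun r _ => (hf r).continuousAt.continuousWithinAt)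
        (fun r _ => (hf r).hasDerivWithinAt) fun r hr => ?_
      rw [interior_Ici] at hr
      have hr' : r₀ < r := hr
      have h1 : r₀ * g r₀ ≤ r * g r := hGmono hr₀ (hr₀.trans hr'.le) hr'.le
      by_contra! hneg
      nlinarith
    obtain ⟨r, hr, hlt⟩ := hnot (f r₀) (hpos r₀) r₀
    exact absurd (hfm self_mem_Ici hr hr) (not_le.2 hlt)
  have hgneg : ∀ r, R ≤ r → g r ≤ 0 := fun r hr => by
    have := hGneg r hr
    by_contra! hp
    nlinarith
  have hfanti : AntitoneOn f (Ici R) := by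
    refine antitoneOn_of_hasDerivWithinAt_nonpos (convex_Ici R)
      (fun r _ => (hf r).continuousAt.continuousWithinAt)
      (fun r _ => (hf r).hasDerivWithinAt) fun r hr => ?_
    rw [interior_Ici] at hr
    exact hgneg r (le_of_lt hr)
  set K := -(R * g R) with hK
  have hK0 : 0 ≤ K := by linarith [hGneg R le_rfl]
  have hlow : ∀ r, R ≤ r → -K ≤ r * g r := fun r hr => by
    have : R * g R ≤ r * g r := hGmono self_mem_Ici hr hr
    linarith
  refine ⟨16 * K / c + K, fun r hr => ⟨?_, ?_⟩⟩
  -- The mean value theorem on `[r / 2, r]`: the increment of `r * g r` is at most `K` and, `f`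
  -- being decreasing, at least `c s⁴ f(r)`. The factor `16` is `(r / s)⁴`.
  · set s := r / 2 with hs
    have hsR : R ≤ s := by linarith
    have hrs : r = 2 * s := by linarith
    have hlt : s < r := by linarith
    obtain ⟨ξ, hξ, hξe⟩ := exists_hasDerivAt_eq_slope (fun r => r * g r) _ hlt
      (fun t _ => (hg t).continuousAt.continuousWithinAt) fun t _ => hg t
    have hWξ := hW ξ (hsR.trans hξ.1.le)
    have hfξ : f r ≤ f ξ := hfanti (hsR.trans hξ.1.le) (hsR.trans hlt.le) hξ.2.le
    rw [eq_div_iff (by linarith)] at hξe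
    have h1 : r * g r - s * g s ≤ K := by
      linarith [hlow s hsR, hGneg r (by linarith)]
    have hs0 : 0 < s := by linarith
    have h2 : c * s ^ 4 * f r ≤ ξ * W ξ * f ξ * (r - s) := by
      have e1 : r - s = s := by linarith
      rw [e1]
      have a1 : s * (c * s ^ 2) ≤ ξ * W ξ := by
        refine mul_le_mul hξ.1.le (le_trans ?_ hWξ) (by positivity) (by linarith [hξ.1])
        have := hξ.1.le
        gcongr
      have a2 : s * (c * s ^ 2) * f r ≤ ξ * W ξ * f ξ :=
        mul_le_mul a1 hfξ (hpos r).le (le_trans (by positivity) a1)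
      calc c * s ^ 4 * f r = s * (c * s ^ 2) * f r * s := by ring
        _ ≤ _ := mul_le_mul_of_nonneg_right a2 hs0.le
    have h3 : c * s ^ 4 * f r ≤ K := by linarith
    have h4 : r ^ 4 * f r ≤ 16 * K / c := by
      have : r ^ 4 = 16 * s ^ 4 := by
        rw [hs]
        ring
      rw [le_div_iff₀ hc, this]
      linarith
    linarith
  · have hrR : R ≤ r := by linarith
    rw [abs_of_nonpos (hgneg r hrR)]
    have := hlow r hrR
    have : 0 ≤ 16 * K / c := by positivity
    linarith

/-! ### Rotations about the left well -/

/-- Polar coordinates centered at the left well. -/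
noncomputable def leftPolar (L r t : ℝ) : ℝ × ℝ := (-(L / 2) + r * Real.cos t, r * Real.sin t)

theorem distSq_leftPolar (L r t : ℝ) : distSq (leftWell L) (leftPolar L r t) = r ^ 2 := by
  simp only [distSq, leftWell, leftPolar]
  linear_combination r ^ 2 * Real.cos_sq_add_sin_sq t

theorem exists_leftPolar (L : ℝ) (x : ℝ × ℝ) :
    ∃ t, x = leftPolar L (Real.sqrt (distSq (leftWell L) x)) t := by
  let z : ℂ := ⟨x.1 + L / 2, x.2⟩
  have hn : ‖z‖ = Real.sqrt (distSq (leftWell L) x) := by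
    rw [Complex.norm_def, Complex.normSq_apply]
    congr 1
    simp only [distSq, leftWell, z]
    ring
  refine ⟨z.arg, ?_⟩
  rw [← hn, leftPolar, Complex.norm_mul_cos_arg, Complex.norm_mul_sin_arg]
  ext <;> simp [z]

theorem hasDerivAt_leftPolar_angle (L r t : ℝ) :
    HasDerivAt (leftPolar L r) (-(r * Real.sin t), r * Real.cos t) t := by
  have := (((Real.hasDerivAt_cos t).const_mul r).const_add (-(L / 2))).prodMk
    ((Real.hasDerivAt_sin t).const_mul r)
  convert! this using 1
  simp

theorem hasDerivAt_leftPolar_radius (L r t : ℝ) :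
    HasDerivAt (fun s => leftPolar L s t) (Real.cos t, Real.sin t) r := by
  have := (((hasDerivAt_id r).mul_const (Real.cos t)).const_add (-(L / 2))).prodMk
    ((hasDerivAt_id r).mul_const (Real.sin t))
  convert! this using 1
  simp

theorem fderiv_angular_eq_zero {L : ℝ} {f : ℝ × ℝ → ℝ} (hf : Differentiable ℝ f)
    (hrad : ∀ x y, distSq (leftWell L) x = distSq (leftWell L) y → f x = f y) (x : ℝ × ℝ) :
    fderiv ℝ f x (-x.2, x.1 + L / 2) = 0 := by
  obtain ⟨t, ht⟩ := exists_leftPolar L x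
  set r := Real.sqrt (distSq (leftWell L) x)
  have h1 := (hf (leftPolar L r t)).hasFDerivAt.comp_hasDerivAt t
    (hasDerivAt_leftPolar_angle L r t)
  have h2 : f ∘ leftPolar L r = fun _ => f (leftPolar L r 0) := by
    funext s
    exact hrad _ _ (by rw [distSq_leftPolar, distSq_leftPolar])
  rw [h2] at h1
  have h3 := h1.unique (hasDerivAt_const t _)
  rw [← ht] at h3
  have e : (-x.2, x.1 + L / 2) = (-(r * Real.sin t), r * Real.cos t) := by
    rw [ht]
    simp [leftPolar]
  rw [e, h3]

theorem eq_of_fderiv_angular_eq_zero {L : ℝ} {f : ℝ × ℝ → ℝ} (hf : Differentiable ℝ f)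
    (hang : ∀ x : ℝ × ℝ, fderiv ℝ f x (-x.2, x.1 + L / 2) = 0) (r t : ℝ) :
    f (leftPolar L r t) = f (leftPolar L r 0) := by
  have hd : ∀ s, HasDerivAt (f ∘ leftPolar L r) 0 s := fun s => by
    have h1 := (hf (leftPolar L r s)).hasFDerivAt.comp_hasDerivAt s
      (hasDerivAt_leftPolar_angle L r s)
    convert! h1 using 1
    rw [← hang (leftPolar L r s)]
    congr 1
    simp [leftPolar]
  exact is_const_of_deriv_eq_zero (fun s => (hd s).differentiableAt) (fun s => (hd s).deriv) t 0

/-- The divergence is the angular derivative of the radial factor, which depends only on the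
distance to the well. -/
theorem divergence_leftPotential {a b₀ b₁ : ℝ} {β : ℝ → ℝ} (hβ : IsProfile a b₀ b₁ β) (L : ℝ)
    (x : ℝ × ℝ) :
    partial₁ (fun y => (leftPotential L β y).1) x + partial₂ (fun y => (leftPotential L β y).2) x
      = 0 := by
  have hd := (contDiff_leftFactor hβ L).differentiable one_ne_zero
  have h := (hd x).hasFDerivAt
  have e1 : fderiv ℝ (fun y => -(leftFactor L β y * y.2)) x = _ :=
    (h.mul (hasFDerivAt_snd (𝕜 := ℝ) (p := x))).neg.fderiv
  have e2 : fderiv ℝ (fun y => leftFactor L β y * (y.1 + L / 2)) x = _ :=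
    (h.mul ((hasFDerivAt_fst (𝕜 := ℝ) (p := x)).add_const (L / 2))).fderiv
  have key := fderiv_angular_eq_zero hd (fun y z hyz => leftFactor_congr (β := β) hyz) x
  rw [fderiv_apply_eq_partials] at key
  simp only [leftPotential_eq]
  rw [partial₁, partial₂, e1, e2]
  simp only [partial₁, partial₂, smul_eq_mul] at key
  simp
  linarith

/-! ### The positive groundstate of the left well -/

section Groundstate

variable {a L b₀ b₁ h μ : ℝ} {β : ℝ → ℝ} {φ : ℝ × ℝ → ℝ}

theorem sq_leftPotential (L : ℝ) (β : ℝ → ℝ) (x : ℝ × ℝ) :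
    (leftPotential L β x).1 ^ 2 + (leftPotential L β x).2 ^ 2
      = distSq (leftWell L) x * leftFactor L β x ^ 2 := by
  rw [leftPotential_eq]
  simp only [distSq, leftWell]
  ring

/-- Imaginary and real parts of the eigenvalue equation. In the imaginary part the factor `h *
leftFactor L β x` is nonzero and can be cancelled, leaving the angular derivative. -/
theorem groundstate_equations (hβ : IsProfile a b₀ b₁ β) (hb₀ : 0 < b₀) (hh : 0 < h)
    (hφ : IsPositiveGroundstate h (leftPotential L β) μ φ) (x : ℝ × ℝ) :
    fderiv ℝ φ x (-x.2, x.1 + L / 2) = 0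
      ∧ h ^ 2 * (partial₁ (partial₁ φ) x + partial₂ (partial₂ φ) x)
        = (distSq (leftWell L) x * leftFactor L β x ^ 2 - μ) * φ x := by
  have heq := hφ.equation x
  rw [magneticLaplacian_ofReal hφ.smooth h
    ((contDiff_leftPotential hβ L).differentiable one_ne_zero x),
    divergence_leftPotential hβ, sq_leftPotential] at heq
  have hre := congrArg Complex.re heq
  have him := congrArg Complex.im heq
  simp only [Complex.add_re, Complex.add_im, Complex.mul_re, Complex.mul_im, Complex.ofReal_re,
    Complex.ofReal_im, Complex.I_re, Complex.I_im] at hre him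
  constructor
  · have hΓ := (leftFactor_bounds hβ L x).1
    have hΓ0 : leftFactor L β x ≠ 0 := by linarith
    rw [leftPotential_eq] at him
    rw [fderiv_apply_eq_partials]
    simp only [smul_eq_mul] at him ⊢
    have h2 : h * leftFactor L β x * (-x.2 * partial₁ φ x + (x.1 + L / 2) * partial₂ φ x) = 0 := by
      linarith
    exact (mul_eq_zero.1 h2).resolve_left (mul_ne_zero hh.ne' hΓ0)
  · linarith

/-- The profile of a function along the ray from the left well. -/
noncomputable def rayProfile (L : ℝ) (φ : ℝ × ℝ → ℝ) (r : ℝ) : ℝ := φ (leftPolar L r 0)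

theorem hasDerivAt_rayProfile {f : ℝ × ℝ → ℝ} (hf : Differentiable ℝ f) (r : ℝ) :
    HasDerivAt (rayProfile L f) (rayProfile L (partial₁ f) r) r := by
  have := (hf (leftPolar L r 0)).hasFDerivAt.comp_hasDerivAt r (hasDerivAt_leftPolar_radius L r 0)
  simp only [Real.cos_zero, Real.sin_zero] at this
  exact this

theorem contDiff_partial₁ {f : ℝ × ℝ → ℝ} (hf : ContDiff ℝ ∞ f) : ContDiff ℝ ∞ (partial₁ f) :=
  contDiff_fderiv_apply hf _

theorem contDiff_partial₂ {f : ℝ × ℝ → ℝ} (hf : ContDiff ℝ ∞ f) : ContDiff ℝ ∞ (partial₂ f) :=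
  contDiff_fderiv_apply hf _

theorem continuous_rayProfile {f : ℝ × ℝ → ℝ} (hf : Continuous f) :
    Continuous (rayProfile L f) := by
  unfold rayProfile leftPolar
  fun_prop

/-- The radial equation in divergence form `(r f')' = r W f`, which avoids dividing by `r` and holds
on all of `ℝ`. -/
theorem groundstate_ray_ode (hβ : IsProfile a b₀ b₁ β) (hb₀ : 0 < b₀) (hh : 0 < h)
    (hφ : IsPositiveGroundstate h (leftPotential L β) μ φ) (r : ℝ) :
    HasDerivAt (fun r => r * rayProfile L (partial₁ φ) r)
      (r * ((r ^ 2 * leftFactor L β (leftPolar L r 0) ^ 2 - μ) / h ^ 2) * rayProfile L φ r) r := by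
  have h1 := contDiff_partial₁ hφ.smooth
  have h2 := contDiff_partial₂ hφ.smooth
  set x := leftPolar L r 0 with hx
  have hx1 : x.1 + L / 2 = r := by simp [hx, leftPolar]
  have hx2 : x.2 = 0 := by simp [hx, leftPolar]
  have hang : (fun y : ℝ × ℝ => -y.2 * partial₁ φ y + (y.1 + L / 2) * partial₂ φ y)
      = fun _ => 0 := by
    funext y
    have := (groundstate_equations hβ hb₀ hh hφ y).1
    rwa [fderiv_apply_eq_partials] at this
  have hder := ((hasFDerivAt_snd (𝕜 := ℝ) (p := x)).neg.mul
    (h1.differentiable (by simp) x).hasFDerivAt).add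
    (((hasFDerivAt_fst (𝕜 := ℝ) (p := x)).add_const (L / 2)).mul
      (h2.differentiable (by simp) x).hasFDerivAt)
  have hder' : HasFDerivAt
      (fun y : ℝ × ℝ => -y.2 * partial₁ φ y + (y.1 + L / 2) * partial₂ φ y) _ x := hder
  rw [hang] at hder'
  have hzero := congrArg (fun l : ℝ × ℝ →L[ℝ] ℝ => l (0, 1)) (hder'.unique (hasFDerivAt_const 0 x))
  -- Differentiating the angular identity across the ray produces the first-order term of the polar
  -- Laplacian.
  have hT : r * partial₂ (partial₂ φ) x = partial₁ φ x := by
    simp [hx1, hx2] at hzero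
    change _ + (r * partial₂ (partial₂ φ) x) = 0 at hzero
    linarith
  have hlap := (groundstate_equations hβ hb₀ hh hφ x).2
  rw [hx, distSq_leftPolar, ← hx] at hlap
  have hd := (hasDerivAt_id r).mul (hasDerivAt_rayProfile (L := L)
    (h1.differentiable (by simp)) r)
  convert! hd using 1
  have hh2 : h ^ 2 ≠ 0 := by positivity
  have e : (r ^ 2 * leftFactor L β x ^ 2 - μ) / h ^ 2 * φ x
      = partial₁ (partial₁ φ) x + partial₂ (partial₂ φ) x := by
    field_simp
    linarith
  simp only [rayProfile, ← hx, id, one_mul]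
  rw [mul_assoc, e, mul_add, hT]
  ring

theorem groundstate_eq_rayProfile (hβ : IsProfile a b₀ b₁ β) (hb₀ : 0 < b₀) (hh : 0 < h)
    (hφ : IsPositiveGroundstate h (leftPotential L β) μ φ) (r t : ℝ) :
    φ (leftPolar L r t) = rayProfile L φ r :=
  eq_of_fderiv_angular_eq_zero (hφ.smooth.differentiable (by simp))
    (fun x => (groundstate_equations hβ hb₀ hh hφ x).1) r t

/-- Both functions belong to the least eigenvalue, so their profiles solve the same ODE and are
proportional; positivity and normalization fix the constant. -/
theorem groundstate_unique (hβ : IsProfile a b₀ b₁ β) (hb₀ : 0 < b₀) (hh : 0 < h)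
    (hφ : IsPositiveGroundstate h (leftPotential L β) μ φ) {μ' : ℝ} {ψ : ℝ × ℝ → ℝ}
    (hψ : IsPositiveGroundstate h (leftPotential L β) μ' ψ) : φ = ψ := by
  obtain rfl : μ = μ' := hφ.least.unique hψ.least
  have hray := eq_const_mul_of_radial_ode
    (fun r => hasDerivAt_rayProfile (L := L) (hφ.smooth.differentiable (by simp)) r)
    (groundstate_ray_ode hβ hb₀ hh hφ)
    (fun r => hasDerivAt_rayProfile (L := L) (hψ.smooth.differentiable (by simp)) r)
    (groundstate_ray_ode hβ hb₀ hh hψ)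
    (continuous_rayProfile (contDiff_partial₁ hφ.smooth).continuous)
    (continuous_rayProfile (contDiff_partial₁ hψ.smooth).continuous)
    (fun r => (hψ.pos _).ne')
  set k := rayProfile L φ 0 / rayProfile L ψ 0 with hk
  have hk0 : 0 < k := div_pos (hφ.pos _) (hψ.pos _)
  have hprop : ∀ x, φ x = k * ψ x := fun x => by
    obtain ⟨t, ht⟩ := exists_leftPolar L x
    rw [ht, groundstate_eq_rayProfile hβ hb₀ hh hφ, groundstate_eq_rayProfile hβ hb₀ hh hψ, hray]
  have hn := hφ.normalized
  simp only [hprop, mul_pow] at hn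
  rw [integral_const_mul, hψ.normalized, mul_one] at hn
  have hk1 : k = 1 := by nlinarith
  funext x
  rw [hprop, hk1, one_mul]

/-! ### Decay of the groundstate at infinity. -/

theorem IsPositiveGroundstate.integrable_sq {A : ℝ × ℝ → ℝ × ℝ}
    -- The integral of a non-integrable function is `0` by convention, so normalization to `1`
    -- already contains integrability.
    (hφ : IsPositiveGroundstate h A μ φ) : Integrable fun x => φ x ^ 2 := by
  by_contra hcon
  have := hφ.normalized
  rw [integral_undef hcon] at this
  exact zero_ne_one this

/-- Otherwise a superlevel set of `φ²` would contain a half-plane, of infinite measure, against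
Chebyshev's inequality for an integrable function. -/
theorem groundstate_rayProfile_not_bounded_below (hβ : IsProfile a b₀ b₁ β) (hb₀ : 0 < b₀)
    (hh : 0 < h) (hL : 0 < L) (hφ : IsPositiveGroundstate h (leftPotential L β) μ φ)
    (ε : ℝ) (hε : 0 < ε) (r₀ : ℝ) : ∃ r, r₀ ≤ r ∧ rayProfile L φ r < ε := by
  by_contra! hcon
  have hfin := hφ.integrable_sq.measure_ge_lt_top (pow_pos hε 2)
  have hsub : Ioi (max r₀ 0) ×ˢ (univ : Set ℝ) ⊆ {x | ε ^ 2 ≤ φ x ^ 2} := by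
    rintro x ⟨hx, -⟩
    have hx' : max r₀ 0 < x.1 := hx
    obtain ⟨t, ht⟩ := exists_leftPolar L x
    have hr : r₀ ≤ Real.sqrt (distSq (leftWell L) x) := by
      refine Real.le_sqrt_of_sq_le ?_ |>.trans' (le_max_left r₀ 0)
      simp only [distSq, leftWell]
      have h0 : 0 ≤ max r₀ 0 := le_max_right _ _
      nlinarith [sq_nonneg (x.2 - 0)]
    have := hcon _ hr
    change ε ^ 2 ≤ φ x ^ 2
    rw [ht, groundstate_eq_rayProfile hβ hb₀ hh hφ]
    exact pow_le_pow_left₀ hε.le this 2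
  have := (measure_mono hsub).trans_lt hfin
  rw [Measure.volume_eq_prod, Measure.prod_prod] at this
  simp at this

theorem partials_eq_of_radial (hβ : IsProfile a b₀ b₁ β) (hb₀ : 0 < b₀) (hh : 0 < h)
    (hφ : IsPositiveGroundstate h (leftPotential L β) μ φ) {r : ℝ} (hr : r ≠ 0) (t : ℝ) :
    partial₁ φ (leftPolar L r t) = Real.cos t * rayProfile L (partial₁ φ) r
      ∧ partial₂ φ (leftPolar L r t) = Real.sin t * rayProfile L (partial₁ φ) r := by
  have hd : Differentiable ℝ φ := hφ.smooth.differentiable (by simp)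
  have h1 := (hd (leftPolar L r t)).hasFDerivAt.comp_hasDerivAt r
    (hasDerivAt_leftPolar_radius L r t)
  have h2 : (φ ∘ fun s => leftPolar L s t) = rayProfile L φ := by
    funext s
    exact groundstate_eq_rayProfile hβ hb₀ hh hφ s t
  rw [h2] at h1
  have h3 := h1.unique (hasDerivAt_rayProfile hd r)
  have h4 := (groundstate_equations hβ hb₀ hh hφ (leftPolar L r t)).1
  rw [fderiv_apply_eq_partials] at h3 h4
  simp only [leftPolar, smul_eq_mul] at h3 h4
  simp only [leftPolar]
  set X := partial₁ φ (-(L / 2) + r * Real.cos t, r * Real.sin t)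
  set Y := partial₂ φ (-(L / 2) + r * Real.cos t, r * Real.sin t)
  have h5 : r * (-Real.sin t * X + Real.cos t * Y) = 0 := by linarith
  have h6 := (mul_eq_zero.1 h5).resolve_left hr
  have hcs := Real.cos_sq_add_sin_sq t
  constructor
  · rw [← h3]
    linear_combination -Real.sin t * h6 - X * hcs
  · rw [← h3]
    linear_combination Real.cos t * h6 - Y * hcs

/-- Compactness handles a box containing the disc of radius `2 * R`; outside it, the radial ODE
gives the decay. -/
theorem groundstate_decay (hβ : IsProfile a b₀ b₁ β) (hb₀ : 0 < b₀) (hh : 0 < h) (hL : 0 < L)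
    (hφ : IsPositiveGroundstate h (leftPotential L β) μ φ) :
    ∃ C, ∀ x, φ x * (1 + distSq (leftWell L) x) ^ 2 ≤ C
      ∧ partial₁ φ x ^ 2 * (1 + distSq (leftWell L) x) ≤ C
      ∧ partial₂ φ x ^ 2 * (1 + distSq (leftWell L) x) ≤ C := by
  -- The squared potential is at least `b₀² r² / 4`; for `r ≥ R` at most half of this is spent on
  -- `μ`.
  set c := b₀ ^ 2 / (8 * h ^ 2) with hc
  have hc0 : 0 < c := by positivity
  obtain ⟨R, hR1, hRμ⟩ : ∃ R : ℝ, 1 ≤ R ∧ ∀ r, R ≤ r → 8 * μ ≤ b₀ ^ 2 * r ^ 2 := by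
    refine ⟨1 + 8 * |μ| / b₀ ^ 2, by linarith [show 0 ≤ 8 * |μ| / b₀ ^ 2 by positivity],
      fun r hr => ?_⟩
    have h1 : 8 * |μ| / b₀ ^ 2 ≤ r ^ 2 := by
      have : 0 ≤ 8 * |μ| / b₀ ^ 2 := by positivity
      nlinarith
    rw [div_le_iff₀ (by positivity)] at h1
    linarith [le_abs_self μ]
  obtain ⟨C, hC⟩ := radial_ode_decay
    (fun r => hasDerivAt_rayProfile (L := L) (hφ.smooth.differentiable (by simp)) r)
    (groundstate_ray_ode hβ hb₀ hh hφ) (fun r => hφ.pos _) hc0 hR1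
    (fun r hr => by
      have hΓ := (leftFactor_bounds hβ L (leftPolar L r 0)).1
      have h1 : b₀ ^ 2 / 4 ≤ leftFactor L β (leftPolar L r 0) ^ 2 := by nlinarith
      have h2 := hRμ r hr
      rw [le_div_iff₀ (by positivity), hc]
      have e : b₀ ^ 2 / (8 * h ^ 2) * r ^ 2 * h ^ 2 = b₀ ^ 2 * r ^ 2 / 8 := by
        field_simp
      rw [e]
      nlinarith [mul_le_mul_of_nonneg_left h1 (sq_nonneg r)])
    (groundstate_rayProfile_not_bounded_below hβ hb₀ hh hL hφ)
  have hφc := hφ.smooth.continuous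
  have h1c := (contDiff_partial₁ hφ.smooth).continuous
  have h2c := (contDiff_partial₂ hφ.smooth).continuous
  have hqc : Continuous (distSq (leftWell L)) := (contDiff_distSq (n := 0) _).continuous
  set K : Set (ℝ × ℝ) := Icc (-(L / 2) - 2 * R) (-(L / 2) + 2 * R) ×ˢ Icc (-(2 * R)) (2 * R)
  have hK : IsCompact K := isCompact_Icc.prod isCompact_Icc
  obtain ⟨C₀, hC₀⟩ := hK.exists_bound_of_continuousOn
    (f := fun x => φ x * (1 + distSq (leftWell L) x) ^ 2) (by fun_prop)
  obtain ⟨C₁, hC₁⟩ := hK.exists_bound_of_continuousOn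
    (f := fun x => partial₁ φ x ^ 2 * (1 + distSq (leftWell L) x)) (by fun_prop)
  obtain ⟨C₂, hC₂⟩ := hK.exists_bound_of_continuousOn
    (f := fun x => partial₂ φ x ^ 2 * (1 + distSq (leftWell L) x)) (by fun_prop)
  refine ⟨|C₀| + |C₁| + |C₂| + 4 * |C| + 2 * C ^ 2, fun x => ?_⟩
  have n0 := abs_nonneg C₀
  have n1 := abs_nonneg C₁
  have n2 := abs_nonneg C₂
  have n3 := abs_nonneg C
  have n4 := sq_nonneg C
  by_cases hx : x ∈ K
  · have b0 := (le_abs_self _).trans ((hC₀ x hx).trans (le_abs_self C₀))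
    have b1 := (le_abs_self _).trans ((hC₁ x hx).trans (le_abs_self C₁))
    have b2 := (le_abs_self _).trans ((hC₂ x hx).trans (le_abs_self C₂))
    exact ⟨by linarith, by linarith, by linarith⟩
  · obtain ⟨t, ht⟩ := exists_leftPolar L x
    set r := Real.sqrt (distSq (leftWell L) x) with hr
    have hr2 : distSq (leftWell L) x = r ^ 2 := (Real.sq_sqrt (distSq_nonneg _ _)).symm
    have hrR : 2 * R ≤ r := by
      by_contra! hlt
      refine hx ?_
      have hr0 : 0 ≤ r := Real.sqrt_nonneg _
      have hq : (x.1 + L / 2) ^ 2 + x.2 ^ 2 ≤ (2 * R) ^ 2 := by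
        have : distSq (leftWell L) x = (x.1 + L / 2) ^ 2 + x.2 ^ 2 := by
          simp only [distSq, leftWell]
          ring
        nlinarith
      have q1 := abs_le_of_sq_le_sq' (show (x.1 + L / 2) ^ 2 ≤ (2 * R) ^ 2 by
        nlinarith [sq_nonneg x.2]) (by linarith)
      have q2 := abs_le_of_sq_le_sq' (show x.2 ^ 2 ≤ (2 * R) ^ 2 by
        nlinarith [sq_nonneg (x.1 + L / 2)]) (by linarith)
      exact ⟨⟨by linarith [q1.1], by linarith [q1.2]⟩, q2⟩
    obtain ⟨d1, d2⟩ := hC r hrR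
    have hr1 : 1 ≤ r ^ 2 := by nlinarith
    have hCC := le_abs_self C
    have hfpos : 0 < rayProfile L φ r := hφ.pos _
    have hgr : rayProfile L (partial₁ φ) r ^ 2 * (1 + r ^ 2) ≤ 2 * C ^ 2 := by
      have hp : 0 ≤ r * |rayProfile L (partial₁ φ) r| := by
        have := abs_nonneg (rayProfile L (partial₁ φ) r)
        have : 0 ≤ r := by linarith
        positivity
      have : (r * |rayProfile L (partial₁ φ) r|) ^ 2 ≤ C ^ 2 := pow_le_pow_left₀ hp d2 2
      rw [mul_pow, sq_abs] at this
      nlinarith [sq_nonneg (rayProfile L (partial₁ φ) r)]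
    obtain ⟨p1, p2⟩ := partials_eq_of_radial hβ hb₀ hh hφ (show r ≠ 0 by linarith) t
    rw [hr2, ht, groundstate_eq_rayProfile hβ hb₀ hh hφ, p1, p2, mul_pow, mul_pow]
    have hg0 : 0 ≤ rayProfile L (partial₁ φ) r ^ 2 * (1 + r ^ 2) := by positivity
    refine ⟨?_, ?_, ?_⟩
    · have : (1 + r ^ 2) ^ 2 ≤ 4 * r ^ 4 := by nlinarith
      nlinarith
    · have := Real.cos_sq_le_one t
      nlinarith
    · have := Real.sin_sq_le_one t
      nlinarith

end Groundstate

/-! ### Calculus of the momenta -/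

section Momentum

variable {h : ℝ} {v : ℝ × ℝ} {α α' : ℝ × ℝ → ℝ}

/-- The phase factor `e^{iσ/h}`. -/
noncomputable def phase (h : ℝ) (σ : ℝ × ℝ → ℝ) (x : ℝ × ℝ) : ℂ :=
  Complex.exp (Complex.I * σ x / h)

theorem norm_phase (h : ℝ) (σ : ℝ × ℝ → ℝ) (x : ℝ × ℝ) : ‖phase h σ x‖ = 1 := by
  have : Complex.I * σ x / h = ((σ x / h : ℝ) : ℂ) * Complex.I := by
    push_cast
    ring
  rw [phase, this, Complex.norm_exp_ofReal_mul_I]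

theorem phase_mul_conj_phase (h : ℝ) (σ τ : ℝ × ℝ → ℝ) (x : ℝ × ℝ) :
    phase h σ x * (starRingEnd ℂ) (phase h τ x)
      = Complex.exp (-Complex.I * ((τ x - σ x : ℝ) : ℂ) / h) := by
  rw [phase, phase, ← Complex.exp_conj, ← Complex.exp_add]
  congr 1
  simp only [map_div₀, map_mul, Complex.conj_I, Complex.conj_ofReal]
  push_cast
  ring

theorem contDiff_phase {σ : ℝ × ℝ → ℝ} (hσ : ContDiff ℝ 1 σ) (h : ℝ) :
    ContDiff ℝ 1 (phase h σ) := by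
  have : ContDiff ℝ 1 fun x => (σ x : ℂ) := Complex.ofRealCLM.contDiff.comp hσ
  exact ((contDiff_const.mul this).div_const _).cexp

theorem contDiff_momentum {u : ℝ × ℝ → ℂ} (hu : ContDiff ℝ ∞ u) (hα : ContDiff ℝ 1 α) (h : ℝ)
    (v : ℝ × ℝ) : ContDiff ℝ 1 (momentum h v α u) := by
  have h1 : ContDiff ℝ 1 fun x => fderiv ℝ u x v :=
    (contDiff_fderiv_apply hu v).of_le (by norm_cast)
  have h2 : ContDiff ℝ 1 fun x => (α x : ℂ) := Complex.ofRealCLM.contDiff.comp hα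
  have h3 : ContDiff ℝ 1 u := hu.of_le (by norm_cast)
  exact (contDiff_const.mul h1).sub (h2.mul h3)

theorem momentum_congr {u w : ℝ × ℝ → ℂ} {x : ℝ × ℝ} (huw : u =ᶠ[nhds x] w) :
    momentum h v α u x = momentum h v α w x := by
  rw [momentum, momentum, huw.fderiv_eq, huw.eq_of_nhds]

theorem momentum_add_const_mul {u w : ℝ × ℝ → ℂ} {x : ℝ × ℝ} (c : ℂ)
    (hu : DifferentiableAt ℝ u x) (hw : DifferentiableAt ℝ w x) :
    momentum h v α (fun y => u y + c * w y) x
      = momentum h v α u x + c * momentum h v α w x := by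
  rw [momentum, momentum, momentum, fderiv_fun_add hu (hw.const_mul c), fderiv_const_mul hw]
  simp only [add_apply, smul_apply, smul_eq_mul]
  ring

/-- Gauge covariance, with the gradient condition needed only at the point and in the one direction.
-/
theorem momentum_phase_mul (hh : h ≠ 0) {σ : ℝ × ℝ → ℝ} {w : ℝ × ℝ → ℂ} {x : ℝ × ℝ}
    (hσ : DifferentiableAt ℝ σ x) (hw : DifferentiableAt ℝ w x)
    (hgrad : fderiv ℝ σ x v = α x - α' x) :
    momentum h v α (fun y => phase h σ y * w y) x = phase h σ x * momentum h v α' w x := by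
  have hσ' : HasFDerivAt (fun y => (σ y : ℂ)) _ x :=
    Complex.ofRealCLM.hasFDerivAt.comp x hσ.hasFDerivAt
  have hp : HasFDerivAt (phase h σ) _ x :=
    ((hσ'.const_mul Complex.I).mul_const ((h : ℂ)⁻¹)).cexp
  have hd : fderiv ℝ (fun y => phase h σ y * w y) x = _ := (hp.mul hw.hasFDerivAt).fderiv
  have hh' : (h : ℂ) ≠ 0 := Complex.ofReal_ne_zero.2 hh
  rw [momentum, hd, momentum]
  simp only [add_apply, smul_apply, ContinuousLinearMap.comp_apply, Complex.ofRealCLM_apply,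
    smul_eq_mul, hgrad]
  have e : Complex.exp (Complex.I * (σ x : ℂ) * (h : ℂ)⁻¹) = phase h σ x := by
    rw [phase, div_eq_mul_inv]
  rw [e]
  push_cast
  field_simp
  linear_combination (-(w x) * (phase h σ x) * (α x - α' x)) * Complex.I_sq

theorem momentum_cutoff_mul {χ : ℝ → ℝ} {w : ℝ × ℝ → ℂ} {x : ℝ × ℝ}
    (hχ : DifferentiableAt ℝ χ x.1) (hw : DifferentiableAt ℝ w x) :
    momentum h v α (fun y => (χ y.1 : ℂ) * w y) x
      = χ x.1 * momentum h v α w x - Complex.I * h * v.1 * ((deriv χ x.1 : ℝ) : ℂ) * w x := by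
  have h1 : HasFDerivAt (fun y : ℝ × ℝ => χ y.1) _ x :=
    hχ.hasDerivAt.comp_hasFDerivAt x (hasFDerivAt_fst (𝕜 := ℝ) (p := x))
  have h2 : HasFDerivAt (fun y : ℝ × ℝ => (χ y.1 : ℂ)) _ x :=
    Complex.ofRealCLM.hasFDerivAt.comp x h1
  have hd : fderiv ℝ (fun y : ℝ × ℝ => (χ y.1 : ℂ) * w y) x = _ :=
    (h2.mul hw.hasFDerivAt).fderiv
  rw [momentum, hd, momentum]
  simp only [add_apply, smul_apply, ContinuousLinearMap.comp_apply, Complex.ofRealCLM_apply,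
    ContinuousLinearMap.coe_fst', smul_eq_mul]
  push_cast
  ring

/-- Pointwise Green's formula: the products `W * conj Z` cancel. Keeping `W` and `Z` as separate
functions allows phases that are only `C¹`. -/
theorem momentum_green {V W U Z : ℝ × ℝ → ℂ} {x : ℝ × ℝ}
    (hV : DifferentiableAt ℝ V x) (hW : DifferentiableAt ℝ W x)
    (hU : DifferentiableAt ℝ U x) (hZ : DifferentiableAt ℝ Z x)
    (hVW : momentum h v α V x = W x) (hUZ : momentum h v α U x = Z x) :
    -Complex.I * h * fderiv ℝ (fun y => W y * (starRingEnd ℂ) (U y)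
        + V y * (starRingEnd ℂ) (Z y)) x v
      = momentum h v α W x * (starRingEnd ℂ) (U x)
        - V x * (starRingEnd ℂ) (momentum h v α Z x) := by
  have hUc : HasFDerivAt (fun y => (starRingEnd ℂ) (U y)) _ x :=
    (Complex.conjCLE : ℂ →L[ℝ] ℂ).hasFDerivAt.comp x hU.hasFDerivAt
  have hZc : HasFDerivAt (fun y => (starRingEnd ℂ) (Z y)) _ x :=
    (Complex.conjCLE : ℂ →L[ℝ] ℂ).hasFDerivAt.comp x hZ.hasFDerivAt
  have hd : fderiv ℝ (fun y => W y * (starRingEnd ℂ) (U y) + V y * (starRingEnd ℂ) (Z y)) x = _ :=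
    ((hW.hasFDerivAt.mul hUc).add (hV.hasFDerivAt.mul hZc)).fderiv
  have hUZc := congrArg (starRingEnd ℂ) hUZ
  rw [hd]
  simp only [momentum, map_sub, map_mul, map_neg, Complex.conj_I, Complex.conj_ofReal] at hVW hUZc ⊢
  simp only [add_apply, smul_apply, ContinuousLinearMap.comp_apply,
    ContinuousLinearEquiv.coe_coe, Complex.conjCLE_apply, smul_eq_mul]
  linear_combination (-W x) * hUZc + (starRingEnd ℂ) (Z x) * hVW

theorem contDiff_cutoff_mul {χ : ℝ → ℝ} (hχ : ContDiff ℝ ∞ χ) {w : ℝ × ℝ → ℂ}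
    (hw : ContDiff ℝ ∞ w) : ContDiff ℝ ∞ fun x : ℝ × ℝ => (χ x.1 : ℂ) * w x :=
  (Complex.ofRealCLM.contDiff.comp (hχ.comp contDiff_fst)).mul hw

end Momentum

section Laplacian

variable {h : ℝ} {A A' : ℝ × ℝ → ℝ × ℝ}

theorem magneticLaplacian_congr {u w : ℝ × ℝ → ℂ} {x : ℝ × ℝ} (huw : u =ᶠ[nhds x] w) :
    magneticLaplacian h A u x = magneticLaplacian h A w x := by
  have e1 : momentum h (1, 0) (fun y => (A y).1) u =ᶠ[nhds x]
      momentum h (1, 0) (fun y => (A y).1) w :=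
    huw.eventuallyEq_nhds.mono fun y hy => momentum_congr hy
  have e2 : momentum h (0, 1) (fun y => (A y).2) u =ᶠ[nhds x]
      momentum h (0, 1) (fun y => (A y).2) w :=
    huw.eventuallyEq_nhds.mono fun y hy => momentum_congr hy
  rw [magneticLaplacian, magneticLaplacian, momentum₁_eq, momentum₂_eq, momentum_congr e1,
    momentum_congr e2]

/-- The gradient condition is needed on an open set because the operator is of second order. The
phase is pulled out after each first-order step, so `σ` is never differentiated twice. -/
theorem magneticLaplacian_phase_mul (hh : h ≠ 0) (hA' : ContDiff ℝ 1 A') {σ : ℝ × ℝ → ℝ}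
    (hσ : ContDiff ℝ 1 σ) {w : ℝ × ℝ → ℂ} (hw : ContDiff ℝ ∞ w) {U : Set (ℝ × ℝ)}
    (hU : IsOpen U)
    (hgrad : ∀ x ∈ U, ∀ v : ℝ × ℝ, fderiv ℝ σ x v
      = ((A x).1 - (A' x).1) * v.1 + ((A x).2 - (A' x).2) * v.2) {x : ℝ × ℝ} (hx : x ∈ U) :
    magneticLaplacian h A (fun y => phase h σ y * w y) x
      = phase h σ x * magneticLaplacian h A' w x := by
  have hσd := hσ.differentiable one_ne_zero
  have hwd : Differentiable ℝ w := hw.differentiable (by simp)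
  have d1 := (contDiff_momentum hw hA'.fst h (1, 0)).differentiable one_ne_zero
  have d2 := (contDiff_momentum hw hA'.snd h (0, 1)).differentiable one_ne_zero
  have g1 : ∀ y ∈ U, fderiv ℝ σ y (1, 0) = (A y).1 - (A' y).1 := fun y hy => by
    rw [hgrad y hy]; ring
  have g2 : ∀ y ∈ U, fderiv ℝ σ y (0, 1) = (A y).2 - (A' y).2 := fun y hy => by
    rw [hgrad y hy]; ring
  have e1 : momentum h (1, 0) (fun y => (A y).1) (fun y => phase h σ y * w y) =ᶠ[nhds x]
      fun y => phase h σ y * momentum h (1, 0) (fun y => (A' y).1) w y :=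
    Filter.eventually_of_mem (hU.mem_nhds hx) fun y hy =>
      momentum_phase_mul hh (hσd y) (hwd y) (g1 y hy)
  have e2 : momentum h (0, 1) (fun y => (A y).2) (fun y => phase h σ y * w y) =ᶠ[nhds x]
      fun y => phase h σ y * momentum h (0, 1) (fun y => (A' y).2) w y :=
    Filter.eventually_of_mem (hU.mem_nhds hx) fun y hy =>
      momentum_phase_mul hh (hσd y) (hwd y) (g2 y hy)
  rw [magneticLaplacian, magneticLaplacian, momentum₁_eq, momentum₂_eq, momentum₁_eq, momentum₂_eq,
    momentum_congr e1, momentum_congr e2,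
    momentum_phase_mul (α' := fun y => (A' y).1) hh (hσd x) (d1 x) (g1 x hx),
    momentum_phase_mul (α' := fun y => (A' y).2) hh (hσd x) (d2 x) (g2 x hx)]
  ring

theorem magneticLaplacian_cutoff_mul (hA : ContDiff ℝ 1 A) {χ : ℝ → ℝ} (hχ : ContDiff ℝ ∞ χ)
    {w : ℝ × ℝ → ℂ} (hw : ContDiff ℝ ∞ w) (x : ℝ × ℝ) :
    magneticLaplacian h A (fun y => (χ y.1 : ℂ) * w y) x
      = χ x.1 * magneticLaplacian h A w x
        - (2 * Complex.I * h * ((deriv χ x.1 : ℝ) : ℂ) * momentum₁ h A w x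
          + h ^ 2 * ((deriv (deriv χ) x.1 : ℝ) : ℂ) * w x) := by
  have hχd : Differentiable ℝ χ := hχ.differentiable (by simp)
  have hχ' : ContDiff ℝ ∞ (deriv χ) := by
    simpa using hχ.iterate_deriv 1
  have hχd' : Differentiable ℝ (deriv χ) := hχ'.differentiable (by simp)
  have hwd : Differentiable ℝ w := hw.differentiable (by simp)
  have d1 := (contDiff_momentum hw hA.fst h (1, 0)).differentiable one_ne_zero
  have d2 := (contDiff_momentum hw hA.snd h (0, 1)).differentiable one_ne_zero
  have e1 : momentum h (1, 0) (fun y => (A y).1) (fun y => (χ y.1 : ℂ) * w y)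
      = fun y => (χ y.1 : ℂ) * momentum h (1, 0) (fun y => (A y).1) w y
        + (-Complex.I * h) * (((deriv χ y.1 : ℝ) : ℂ) * w y) := by
    funext y
    rw [momentum_cutoff_mul (hχd _) (hwd y)]
    push_cast
    ring
  have e2 : momentum h (0, 1) (fun y => (A y).2) (fun y => (χ y.1 : ℂ) * w y)
      = fun y => (χ y.1 : ℂ) * momentum h (0, 1) (fun y => (A y).2) w y := by
    funext y
    rw [momentum_cutoff_mul (hχd _) (hwd y)]
    push_cast
    ring
  have f1 : Differentiable ℝ fun y : ℝ × ℝ =>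
      (χ y.1 : ℂ) * momentum h (1, 0) (fun y => (A y).1) w y :=
    ((Complex.ofRealCLM.differentiable.comp (hχd.comp differentiable_fst))).mul d1
  have f2 : Differentiable ℝ fun y : ℝ × ℝ => ((deriv χ y.1 : ℝ) : ℂ) * w y :=
    ((Complex.ofRealCLM.differentiable.comp (hχd'.comp differentiable_fst))).mul hwd
  rw [magneticLaplacian, magneticLaplacian, momentum₁_eq, momentum₂_eq, e1, e2,
    momentum_add_const_mul _ (f1 x) (f2 x),
    momentum_cutoff_mul (hχd _) (d1 x), momentum_cutoff_mul (hχd' _) (hwd x),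
    momentum_cutoff_mul (hχd _) (d2 x)]
  push_cast
  linear_combination (h ^ 2 * ((deriv (deriv χ) x.1 : ℝ) : ℂ) * w x) * Complex.I_sq

end Laplacian

/-! ### Integration over strips -/

theorem integrable_of_strip_bound {E : Type*} [NormedAddCommGroup E] {g : ℝ × ℝ → E}
    (hg : Continuous g) {s t C : ℝ} (hC : ∀ x, ‖g x‖ ≤ C * (1 + x.2 ^ 2)⁻¹)
    (hzero : ∀ x : ℝ × ℝ, x.1 ∉ Icc s t → g x = 0) : Integrable g := by
  have h1 : Integrable ((Icc s t).indicator fun _ : ℝ => C) :=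
    (integrable_indicator_iff measurableSet_Icc).2 (integrableOn_const (by simp))
  have h2 := h1.mul_prod (ν := volume) integrable_inv_one_add_sq
  refine Integrable.mono' h2 hg.aestronglyMeasurable (.of_forall fun x => ?_)
  by_cases hx : x.1 ∈ Icc s t
  · simpa [hx] using hC x
  · simp [hx, hzero x hx]

/-- The divergence theorem on the rectangles `[0, c] × [-n, n]`: the side at `c` contributes
nothing, the horizontal sides vanish in the limit, and the sign is that of the outer normal at `x.1
= 0`. -/
theorem integral_divergence_strip {E : Type*} [NormedAddCommGroup E] [NormedSpace ℝ E]
    [CompleteSpace E] {F₁ F₂ D : ℝ × ℝ → E} (hF₁ : ContDiff ℝ 1 F₁) (hF₂ : ContDiff ℝ 1 F₂)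
    {c K : ℝ} (hc : 0 < c) (hend : ∀ y, F₁ (c, y) = 0)
    (hbound : ∀ x : ℝ × ℝ, x.1 ∈ Icc 0 c → ‖F₂ x‖ ≤ K * (1 + x.2 ^ 2)⁻¹)
    (hline : Integrable fun y => F₁ (0, y)) (hD : Integrable D)
    (hD0 : ∀ x : ℝ × ℝ, x.1 ∉ Ioc 0 c → D x = 0)
    (hdiv : ∀ x : ℝ × ℝ, x.1 ∈ Ioc 0 c → partial₁ F₁ x + partial₂ F₂ x = D x) :
    ∫ x, D x = -∫ y, F₁ (0, y) := by
  have hrect : ∀ n : ℕ, ∫ z in Ioc 0 c ×ˢ Ioc (-(n : ℝ)) n, D z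
      = (((∫ x in (0 : ℝ)..c, F₂ (x, (n : ℝ))) - ∫ x in (0 : ℝ)..c, F₂ (x, -(n : ℝ))))
        - ∫ y in (-(n : ℝ))..n, F₁ (0, y) := fun n => by
    have hn : -(n : ℝ) ≤ n := by linarith [(Nat.cast_nonneg n : (0 : ℝ) ≤ n)]
    have hcd : Continuous fun x => fderiv ℝ F₁ x (1, 0) + fderiv ℝ F₂ x (0, 1) :=
      ((hF₁.continuous_fderiv one_ne_zero).clm_apply continuous_const).add
        ((hF₂.continuous_fderiv one_ne_zero).clm_apply continuous_const)
    have := integral2_divergence_prod_of_hasFDerivAt F₁ F₂ (fderiv ℝ F₁) (fderiv ℝ F₂)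
      0 (-(n : ℝ)) c n hF₁.continuous.continuousOn hF₂.continuous.continuousOn
      (fun x _ => (hF₁.differentiable one_ne_zero x).hasFDerivAt)
      (fun x _ => (hF₂.differentiable one_ne_zero x).hasFDerivAt)
      (hcd.continuousOn.integrableOn_compact (isCompact_uIcc.prod isCompact_uIcc))
    simp only [hend, intervalIntegral.integral_zero, add_zero] at this
    rw [← this, Measure.volume_eq_prod, setIntegral_prod _ hD.integrableOn,
      intervalIntegral.integral_of_le hc.le]
    refine setIntegral_congr_fun measurableSet_Ioc fun x hx => ?_
    rw [intervalIntegral.integral_of_le hn]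
    exact setIntegral_congr_fun measurableSet_Ioc fun y _ => (hdiv (x, y) hx).symm
  have hUnion : (⋃ n : ℕ, Ioc 0 c ×ˢ Ioc (-(n : ℝ)) n) = Ioc 0 c ×ˢ (univ : Set ℝ) := by
    ext x
    simp only [mem_iUnion, mem_prod, mem_univ, and_true, exists_and_left, and_iff_left_iff_imp]
    intro _
    obtain ⟨n, hn⟩ := exists_nat_gt |x.2|
    exact ⟨n, (abs_lt.1 hn).1, (abs_lt.1 hn).2.le⟩
  have hL : Filter.Tendsto (fun n : ℕ => ∫ z in Ioc 0 c ×ˢ Ioc (-(n : ℝ)) n, D z)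
      Filter.atTop (nhds (∫ x, D x)) := by
    have := tendsto_setIntegral_of_monotone (μ := (volume : Measure (ℝ × ℝ))) (f := D)
      (s := fun n : ℕ => Ioc 0 c ×ˢ Ioc (-(n : ℝ)) n)
      (fun n => measurableSet_Ioc.prod measurableSet_Ioc)
      (fun m n hmn => prod_mono_right (Ioc_subset_Ioc (by simpa using hmn) (by simpa using hmn)))
      hD.integrableOn
    rwa [hUnion, setIntegral_eq_integral_of_forall_compl_eq_zero] at this
    intro x hx
    exact hD0 x fun hx1 => hx ⟨hx1, mem_univ _⟩
  have hside : ∀ ε : ℝ, ε ^ 2 = 1 → Filter.Tendsto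
      (fun n : ℕ => ∫ x in (0 : ℝ)..c, F₂ (x, ε * n)) Filter.atTop (nhds 0) := fun ε hε => by
    have hb : ∀ n : ℕ, ‖∫ x in (0 : ℝ)..c, F₂ (x, ε * n)‖
        ≤ K * (1 + (n : ℝ) ^ 2)⁻¹ * |c - 0| := fun n => by
      refine intervalIntegral.norm_integral_le_of_norm_le_const fun x hx => ?_
      rw [uIoc_of_le hc.le] at hx
      have := hbound (x, ε * n) ⟨hx.1.le, hx.2⟩
      simpa [mul_pow, hε] using this
    refine squeeze_zero_norm hb ?_
    have h1 : Filter.Tendsto (fun n : ℕ => 1 + (n : ℝ) ^ 2) Filter.atTop Filter.atTop :=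
      Filter.tendsto_atTop_add_const_left _ _
        ((Filter.tendsto_pow_atTop two_ne_zero).comp tendsto_natCast_atTop_atTop)
    simpa using (h1.inv_tendsto_atTop.const_mul K).mul_const |c - 0|
  have hR : Filter.Tendsto (fun n : ℕ => ∫ y in (-(n : ℝ))..n, F₁ (0, y)) Filter.atTop
      (nhds (∫ y, F₁ (0, y))) :=
    intervalIntegral_tendsto_integral hline
      (Filter.tendsto_neg_atTop_atBot.comp tendsto_natCast_atTop_atTop) tendsto_natCast_atTop_atTop
  have h1 := hside 1 (by norm_num)
  have h2 := hside (-1) (by norm_num)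
  simp only [one_mul, neg_mul] at h1 h2
  have hlim := (h1.sub h2).sub hR
  rw [sub_zero, zero_sub] at hlim
  refine tendsto_nhds_unique hL ?_
  simpa only [hrect] using hlim

/-! ### Cutoffs -/

section Cutoff

variable {a L η : ℝ} {χ : ℝ → ℝ}

theorem IsLeftCutoff.derivs_eq_zero (hχ : IsLeftCutoff a L η χ) {s : ℝ}
    (hs : s ∉ Icc (L / 2 - a - η) (L / 2 - a - η / 2)) :
    deriv χ s = 0 ∧ deriv (deriv χ) s = 0 := by
  obtain ⟨c, hc⟩ : ∃ c, χ =ᶠ[nhds s] fun _ => c := by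
    rw [mem_Icc, not_and_or, not_le, not_le] at hs
    rcases hs with h | h
    · exact ⟨1, Filter.eventually_of_mem (Iio_mem_nhds h) fun t ht => hχ.eq_one t ht⟩
    · exact ⟨0, Filter.eventually_of_mem (Ioi_mem_nhds h) fun t ht => hχ.eq_zero t ht⟩
  have h1 : deriv χ =ᶠ[nhds s] fun _ => 0 := by
    simpa using hc.deriv
  exact ⟨h1.eq_of_nhds, by simpa using h1.deriv_eq⟩

theorem IsLeftCutoff.exists_bound (hχ : IsLeftCutoff a L η χ) :
    ∃ K, 0 ≤ K ∧ ∀ s, |deriv χ s| ≤ K ∧ |deriv (deriv χ) s| ≤ K := by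
  have hχ' : ContDiff ℝ ∞ (deriv χ) := by simpa using hχ.smooth.iterate_deriv 1
  have hχ'' : ContDiff ℝ ∞ (deriv (deriv χ)) := by simpa using hχ'.iterate_deriv 1
  obtain ⟨K₁, hK₁⟩ := (isCompact_Icc (a := L / 2 - a - η) (b := L / 2 - a - η / 2)
    ).exists_bound_of_continuousOn hχ'.continuous.continuousOn
  obtain ⟨K₂, hK₂⟩ := (isCompact_Icc (a := L / 2 - a - η) (b := L / 2 - a - η / 2)
    ).exists_bound_of_continuousOn hχ''.continuous.continuousOn
  refine ⟨|K₁| + |K₂|, by positivity, fun s => ?_⟩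
  by_cases hs : s ∈ Icc (L / 2 - a - η) (L / 2 - a - η / 2)
  · have h1 := (hK₁ s hs).trans (le_abs_self K₁)
    have h2 := (hK₂ s hs).trans (le_abs_self K₂)
    rw [Real.norm_eq_abs] at h1 h2
    exact ⟨by linarith [abs_nonneg K₂], by linarith [abs_nonneg K₁]⟩
  · obtain ⟨h1, h2⟩ := hχ.derivs_eq_zero hs
    rw [h1, h2, abs_zero]
    exact ⟨by positivity, by positivity⟩

theorem IsRightCutoff.exists_bound (hχ : IsRightCutoff a L η χ) : ∃ K, ∀ s, |χ s| ≤ K := by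
  obtain ⟨K, hK⟩ := (isCompact_Icc (a := -(L / 2 - a - η / 2)) (b := -(L / 2 - a - η))
    ).exists_bound_of_continuousOn hχ.smooth.continuous.continuousOn
  refine ⟨|K| + 1, fun s => ?_⟩
  have := abs_nonneg K
  rcases lt_or_ge s (-(L / 2 - a - η / 2)) with h | h
  · rw [hχ.eq_zero s h, abs_zero]
    positivity
  rcases lt_or_ge (-(L / 2 - a - η)) s with h' | h'
  · rw [hχ.eq_one s h', abs_one]
    linarith
  · have := (hK s ⟨h, h'⟩).trans (le_abs_self K)
    rw [Real.norm_eq_abs] at this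
    linarith

end Cutoff

/-! ### Bounds for the groundstate and the commutator -/

section Bounds

variable {a L b₀ b₁ h μ η : ℝ} {β χ : ℝ → ℝ} {φ : ℝ × ℝ → ℝ}

theorem sq_norm_momentum_ofReal {φ : ℝ × ℝ → ℝ} (hφ : ContDiff ℝ ∞ φ) (h : ℝ) (v : ℝ × ℝ)
    (α : ℝ × ℝ → ℝ) (x : ℝ × ℝ) :
    ‖momentum h v α (fun y => (φ y : ℂ)) x‖ ^ 2
      = h ^ 2 * fderiv ℝ φ x v ^ 2 + α x ^ 2 * φ x ^ 2 := by
  rw [momentum_ofReal hφ, Complex.sq_norm, Complex.normSq_apply]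
  simp
  ring

/-- The linear growth of `A_ℓ` is absorbed by the decay of `φ`. Weights depend on `x.2` alone, since
all later integrals run over strips or over the symmetry line. -/
theorem groundstate_momentum_bounds (hβ : IsProfile a b₀ b₁ β) (hb₀ : 0 < b₀) (hh : 0 < h)
    (hL : 0 < L) (hφ : IsPositiveGroundstate h (leftPotential L β) μ φ) :
    ∃ C, 0 < C ∧ ∀ x, φ x ≤ C * (1 + x.2 ^ 2)⁻¹
      ∧ ‖momentum₁ h (leftPotential L β) (fun y => (φ y : ℂ)) x‖ ≤ C
      ∧ ‖momentum₂ h (leftPotential L β) (fun y => (φ y : ℂ)) x‖ ≤ C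
      ∧ ‖momentum₁ h (leftPotential L β) (fun y => (φ y : ℂ)) x‖ ^ 2 ≤ C * (1 + x.2 ^ 2)⁻¹ := by
  obtain ⟨C, hC⟩ := groundstate_decay hβ hb₀ hh hL hφ
  have hC0 : 0 < C := by
    have := (hC 0).1
    have h1 := hφ.pos 0
    have h2 := distSq_nonneg (leftWell L) 0
    exact lt_of_lt_of_le (by positivity) this
  set D := h ^ 2 * C + b₁ ^ 2 / 4 * C ^ 2 with hD
  have hD0 : 0 ≤ D := by positivity
  refine ⟨1 + C + D, by positivity, fun x => ?_⟩
  obtain ⟨c0, c1, c2⟩ := hC x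
  have hq := distSq_nonneg (leftWell L) x
  have hq2 : x.2 ^ 2 ≤ distSq (leftWell L) x := by
    simp only [distSq, leftWell]
    nlinarith [sq_nonneg (x.1 - -(L / 2))]
  have hA := sq_leftPotential L β x
  have hp := hφ.pos x
  obtain ⟨hΓ1, hΓ2⟩ := leftFactor_bounds hβ L x
  have hΓ : leftFactor L β x ^ 2 ≤ b₁ ^ 2 / 4 := by nlinarith
  set q := distSq (leftWell L) x
  have hφ1 : φ x * (1 + q) ≤ C := by
    have : φ x * (1 + q) ≤ φ x * (1 + q) ^ 2 :=
      mul_le_mul_of_nonneg_left (by nlinarith) hp.le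
    linarith
  have hAφ : ∀ α : ℝ, α ^ 2 ≤ q * leftFactor L β x ^ 2 →
      α ^ 2 * φ x ^ 2 * (1 + q) ≤ b₁ ^ 2 / 4 * C ^ 2 := fun α hα => by
    have e1 : α ^ 2 ≤ b₁ ^ 2 / 4 * (1 + q) := by nlinarith
    have e2 : (φ x * (1 + q)) ^ 2 ≤ C ^ 2 := pow_le_pow_left₀ (by positivity) hφ1 2
    calc α ^ 2 * φ x ^ 2 * (1 + q) ≤ b₁ ^ 2 / 4 * (1 + q) * φ x ^ 2 * (1 + q) := by gcongr
      _ = b₁ ^ 2 / 4 * (φ x * (1 + q)) ^ 2 := by ring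
      _ ≤ _ := by gcongr
  have hm1 : ‖momentum₁ h (leftPotential L β) (fun y => (φ y : ℂ)) x‖ ^ 2 * (1 + q) ≤ D := by
    rw [momentum₁_eq, sq_norm_momentum_ofReal hφ.smooth]
    have e1 := hAφ (leftPotential L β x).1 (by nlinarith [sq_nonneg (leftPotential L β x).2])
    have e2 : h ^ 2 * (partial₁ φ x ^ 2 * (1 + q)) ≤ h ^ 2 * C := by gcongr
    rw [partial₁] at e2
    linarith
  have hm2 : ‖momentum₂ h (leftPotential L β) (fun y => (φ y : ℂ)) x‖ ^ 2 * (1 + q) ≤ D := by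
    rw [momentum₂_eq, sq_norm_momentum_ofReal hφ.smooth]
    have e1 := hAφ (leftPotential L β x).2 (by nlinarith [sq_nonneg (leftPotential L β x).1])
    have e2 : h ^ 2 * (partial₂ φ x ^ 2 * (1 + q)) ≤ h ^ 2 * C := by gcongr
    rw [partial₂] at e2
    linarith
  have hroot : ∀ z : ℝ, z ^ 2 * (1 + q) ≤ D → z ≤ 1 + C + D := fun z hz => by
    nlinarith [sq_nonneg (z - 1), sq_nonneg z, mul_nonneg (sq_nonneg z) hq]
  have hinv : ∀ z : ℝ, 0 ≤ z → z * (1 + q) ≤ 1 + C + D →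
      z ≤ (1 + C + D) * (1 + x.2 ^ 2)⁻¹ := fun z hz0 hz => by
    rw [← div_eq_mul_inv, le_div_iff₀ (by positivity)]
    nlinarith
  exact ⟨hinv _ hp.le (by linarith), hroot _ hm1, hroot _ hm2, hinv _ (sq_nonneg _) (by linarith)⟩

/-- The factor `e^{-iσ_ℓ/h} (ℒ_h - μ) (χ e^{iσ_ℓ/h} φ)`, supported where `χ` varies. -/
noncomputable def commutator (h L : ℝ) (β χ : ℝ → ℝ) (φ : ℝ × ℝ → ℝ) (x : ℝ × ℝ) : ℂ :=
  -(2 * Complex.I * h * ((deriv χ x.1 : ℝ) : ℂ)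
      * momentum₁ h (leftPotential L β) (fun y => (φ y : ℂ)) x
    + h ^ 2 * ((deriv (deriv χ) x.1 : ℝ) : ℂ) * (φ x : ℂ))

theorem contDiff_ofReal_comp {n : WithTop ℕ∞} {f : ℝ × ℝ → ℝ} (hf : ContDiff ℝ n f) :
    ContDiff ℝ n fun x => (f x : ℂ) :=
  Complex.ofRealCLM.contDiff.comp hf

theorem magneticLaplacian_cutoff_groundstate (hβ : IsProfile a b₀ b₁ β)
    (hφ : IsPositiveGroundstate h (leftPotential L β) μ φ) (hχ : ContDiff ℝ ∞ χ) (x : ℝ × ℝ) :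
    magneticLaplacian h (leftPotential L β) (fun y => (χ y.1 : ℂ) * (φ y : ℂ)) x
      = μ * ((χ x.1 : ℂ) * (φ x : ℂ)) + commutator h L β χ φ x := by
  rw [magneticLaplacian_cutoff_mul (contDiff_leftPotential hβ L) hχ
    (contDiff_ofReal_comp hφ.smooth), hφ.equation, commutator]
  ring

theorem commutator_eq_zero (hχ : IsLeftCutoff a L η χ) (h : ℝ) (β : ℝ → ℝ) (φ : ℝ × ℝ → ℝ)
    {x : ℝ × ℝ} (hx : x.1 ∉ Icc (L / 2 - a - η) (L / 2 - a - η / 2)) :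
    commutator h L β χ φ x = 0 := by
  obtain ⟨h1, h2⟩ := hχ.derivs_eq_zero hx
  simp [commutator, h1, h2]

theorem continuous_commutator (hβ : IsProfile a b₀ b₁ β)
    (hφ : IsPositiveGroundstate h (leftPotential L β) μ φ) (hχ : ContDiff ℝ ∞ χ) :
    Continuous (commutator h L β χ φ) := by
  have hχ' : ContDiff ℝ ∞ (deriv χ) := by simpa using hχ.iterate_deriv 1
  have hχ'' : ContDiff ℝ ∞ (deriv (deriv χ)) := by simpa using hχ'.iterate_deriv 1
  have h1 := hχ'.continuous
  have h2 := hχ''.continuous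
  have h3 := hφ.smooth.continuous
  have h4 : Continuous (momentum₁ h (leftPotential L β) fun y => (φ y : ℂ)) :=
    (contDiff_momentum (contDiff_ofReal_comp hφ.smooth) (contDiff_leftPotential hβ L).fst h
      (1, 0)).continuous
  unfold commutator
  fun_prop

theorem commutator_bounds (hβ : IsProfile a b₀ b₁ β) (hb₀ : 0 < b₀) (hh : 0 < h)
    (hL : 0 < L) (hφ : IsPositiveGroundstate h (leftPotential L β) μ φ)
    (hχ : IsLeftCutoff a L η χ) :
    ∃ K, ∀ x, ‖commutator h L β χ φ x‖ ≤ K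
      ∧ ‖commutator h L β χ φ x‖ ^ 2 ≤ K * (1 + x.2 ^ 2)⁻¹ := by
  obtain ⟨C, hC0, hC⟩ := groundstate_momentum_bounds hβ hb₀ hh hL hφ
  obtain ⟨k, hk0, hk⟩ := hχ.exists_bound
  refine ⟨(2 * h * k * C + h ^ 2 * k * C) + (2 * (2 * h * k) ^ 2 * C + 2 * (h ^ 2 * k) ^ 2 * C ^ 2),
    fun x => ?_⟩
  obtain ⟨c1, c2, -, c4⟩ := hC x
  obtain ⟨k1, k2⟩ := hk x.1
  have hp := hφ.pos x
  set m := (1 + x.2 ^ 2)⁻¹ with hm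
  have hm0 : 0 < m := by positivity
  have hm1 : m ≤ 1 := inv_le_one_of_one_le₀ (by nlinarith [sq_nonneg x.2])
  set P := ‖momentum₁ h (leftPotential L β) (fun y => (φ y : ℂ)) x‖
  have hP0 : 0 ≤ P := norm_nonneg _
  have hn : ‖commutator h L β χ φ x‖ ≤ 2 * h * k * P + h ^ 2 * k * φ x := by
    rw [commutator, norm_neg]
    refine (norm_add_le _ _).trans ?_
    simp only [norm_mul, norm_pow, Complex.norm_real, Complex.norm_I, Real.norm_eq_abs,
      abs_of_pos hh, abs_of_pos hp, Complex.norm_ofNat, mul_one]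
    gcongr
  have hφC : φ x ≤ C := c1.trans (by nlinarith)
  have a1 : 0 ≤ 2 * h * k := by positivity
  have a2 : 0 ≤ h ^ 2 * k := by positivity
  constructor
  · have e1 : 2 * h * k * P ≤ 2 * h * k * C := by gcongr
    have e2 : h ^ 2 * k * φ x ≤ h ^ 2 * k * C := by gcongr
    have : 0 ≤ 2 * (2 * h * k) ^ 2 * C + 2 * (h ^ 2 * k) ^ 2 * C ^ 2 := by positivity
    linarith
  · have e0 : ‖commutator h L β χ φ x‖ ^ 2
        ≤ 2 * (2 * h * k) ^ 2 * P ^ 2 + 2 * (h ^ 2 * k) ^ 2 * φ x ^ 2 := by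
      have := pow_le_pow_left₀ (norm_nonneg _) hn 2
      nlinarith [sq_nonneg (2 * h * k * P - h ^ 2 * k * φ x)]
    have e1 : 2 * (2 * h * k) ^ 2 * P ^ 2 ≤ 2 * (2 * h * k) ^ 2 * (C * m) := by gcongr
    have e2 : φ x ^ 2 ≤ C ^ 2 * m := by
      have : φ x ^ 2 ≤ (C * m) ^ 2 := pow_le_pow_left₀ hp.le c1 2
      have : C ^ 2 * m ^ 2 ≤ C ^ 2 * m := by
        gcongr
        nlinarith
      linarith
    have e3 : 2 * (h ^ 2 * k) ^ 2 * φ x ^ 2 ≤ 2 * (h ^ 2 * k) ^ 2 * (C ^ 2 * m) := by gcongr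
    have e4 : 0 ≤ (2 * h * k * C + h ^ 2 * k * C) * m := by positivity
    linarith

end Bounds

/-! ### The interaction integral -/

section Interaction

variable {a L b₀ b₁ h μ η : ℝ} {β χ χ' : ℝ → ℝ} {A : ℝ × ℝ → ℝ × ℝ} {φ : ℝ × ℝ → ℝ}

theorem quasimode_eq (h : ℝ) (χ : ℝ → ℝ) (σ φ : ℝ × ℝ → ℝ) :
    quasimode h χ σ φ = fun y => phase h σ y * ((χ y.1 : ℂ) * (φ y : ℂ)) := by
  funext y
  rw [quasimode, phase]
  ring

/-- Where the gauge change is valid, it reduces to the one-well operator; elsewhere the cutoff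
vanishes in a neighbourhood and both sides are `0`. -/
theorem residual_quasimode (hβ : IsProfile a b₀ b₁ β) (ha : 0 < a) (haL : a < L / 2)
    (hA : ContDiff ℝ 1 A) (hAB : ∀ x, curl A x = doubleField a L b₁ β x) (hh : 0 < h)
    (hφ : IsPositiveGroundstate h (leftPotential L β) μ φ) (hη : 0 < η)
    (hχ : IsLeftCutoff a L η χ) (x : ℝ × ℝ) :
    residual h A μ (quasimode h χ (sigmaLeft L β A) φ) x
      = phase h (sigmaLeft L β A) x * commutator h L β χ φ x := by
  rcases lt_or_ge x.1 (L / 2 - a) with hx | hx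
  · have hU : IsOpen {y : ℝ × ℝ | y.1 < L / 2 - a} := isOpen_lt continuous_fst continuous_const
    rw [residual, quasimode_eq, magneticLaplacian_phase_mul hh.ne' (contDiff_leftPotential hβ L)
      (contDiff_sigmaLeft hβ L hA) (contDiff_cutoff_mul hχ.smooth (contDiff_ofReal_comp hφ.smooth))
      hU (fun y hy v => fderiv_sigmaLeft hβ ha haL hA hAB hy v) hx,
      magneticLaplacian_cutoff_groundstate hβ hφ hχ.smooth]
    ring
  · have hx' : L / 2 - a - η / 2 < x.1 := by linarith
    have hzero : quasimode h χ (sigmaLeft L β A) φ =ᶠ[nhds x] fun _ => 0 := by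
      filter_upwards [(isOpen_lt continuous_const continuous_fst).mem_nhds hx'] with y hy
      rw [quasimode, hχ.eq_zero _ hy]
      simp
    rw [residual, magneticLaplacian_congr hzero, hzero.eq_of_nhds,
      commutator_eq_zero hχ h β φ fun hm => absurd hm.2 (not_le.2 hx')]
    have hm : ∀ v α, momentum h v α (fun _ => 0) = fun _ => 0 := fun v α => by
      funext y
      simp [momentum]
    rw [magneticLaplacian, momentum₁_eq, momentum₂_eq, hm, hm, hm, hm]
    simp

theorem memLp_residual_quasimode (hβ : IsProfile a b₀ b₁ β) (ha : 0 < a) (haL : a < L / 2)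
    (hb₀ : 0 < b₀) (hA : ContDiff ℝ 1 A) (hAB : ∀ x, curl A x = doubleField a L b₁ β x)
    (hh : 0 < h) (hφ : IsPositiveGroundstate h (leftPotential L β) μ φ) (hη : 0 < η)
    (hχ : IsLeftCutoff a L η χ) :
    MemLp (residual h A μ (quasimode h χ (sigmaLeft L β A) φ)) 2 volume := by
  have e : residual h A μ (quasimode h χ (sigmaLeft L β A) φ)
      = fun x => phase h (sigmaLeft L β A) x * commutator h L β χ φ x :=
    funext (residual_quasimode hβ ha haL hA hAB hh hφ hη hχ)
  have hc : Continuous fun x => phase h (sigmaLeft L β A) x * commutator h L β χ φ x :=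
    (contDiff_phase (contDiff_sigmaLeft hβ L hA) h).continuous.mul
      (continuous_commutator hβ hφ hχ.smooth)
  obtain ⟨K, hK⟩ := commutator_bounds hβ hb₀ hh (by linarith) hφ hχ
  rw [e, memLp_two_iff_integrable_sq_norm hc.aestronglyMeasurable]
  refine integrable_of_strip_bound (s := L / 2 - a - η) (t := L / 2 - a - η / 2) (C := K)
    (by fun_prop) (fun x => ?_) fun x hx => ?_
  · rw [norm_mul, norm_phase, one_mul, norm_pow, norm_norm]
    exact (hK x).2
  · rw [commutator_eq_zero hχ h β φ hx]
    simp

theorem memLp_quasimode {A' : ℝ × ℝ → ℝ × ℝ} {σ : ℝ × ℝ → ℝ} (hσ : Continuous σ)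
    (hφ : IsPositiveGroundstate h A' μ φ) (hχ : IsRightCutoff a L η χ) :
    MemLp (quasimode h χ σ φ) 2 volume := by
  obtain ⟨K, hK⟩ := hχ.exists_bound
  have hφc := hφ.smooth.continuous
  have hχc := hχ.smooth.continuous
  have hc : Continuous (quasimode h χ σ φ) := by
    unfold quasimode
    fun_prop
  rw [memLp_two_iff_integrable_sq_norm hc.aestronglyMeasurable]
  refine (hφ.integrable_sq.const_mul (K ^ 2)).mono'
    (hc.norm.pow 2).aestronglyMeasurable (.of_forall fun x => ?_)
  rw [quasimode_eq, norm_mul, norm_phase, one_mul, norm_pow, norm_norm, norm_mul, mul_pow,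
    Complex.norm_real, Complex.norm_real, Real.norm_eq_abs, Real.norm_eq_abs, sq_abs (φ x)]
  have := pow_le_pow_left₀ (abs_nonneg _) (hK x.1) 2
  gcongr

/-- The component in the direction `v` of the current in Green's formula for the quasimodes. -/
noncomputable def current (h : ℝ) (v : ℝ × ℝ) (α α' : ℝ × ℝ → ℝ) (σ σ' : ℝ × ℝ → ℝ)
    (u u' : ℝ × ℝ → ℂ) (y : ℝ × ℝ) : ℂ :=
  (phase h σ y * momentum h v α u y) * (starRingEnd ℂ) (phase h σ' y * u' y)
    + (phase h σ y * u y) * (starRingEnd ℂ) (phase h σ' y * momentum h v α' u' y)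

theorem contDiff_conj {f : ℝ × ℝ → ℂ} (hf : ContDiff ℝ 1 f) :
    ContDiff ℝ 1 fun x => (starRingEnd ℂ) (f x) :=
  Complex.conjCLE.contDiff.comp hf

theorem contDiff_current {v : ℝ × ℝ} {α α' σ σ' : ℝ × ℝ → ℝ} {u u' : ℝ × ℝ → ℂ}
    (hα : ContDiff ℝ 1 α) (hα' : ContDiff ℝ 1 α') (hσ : ContDiff ℝ 1 σ) (hσ' : ContDiff ℝ 1 σ')
    (hu : ContDiff ℝ ∞ u) (hu' : ContDiff ℝ ∞ u') (h : ℝ) :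
    ContDiff ℝ 1 (current h v α α' σ σ' u u') := by
  have p := contDiff_phase hσ h
  have p' := contDiff_phase hσ' h
  have m := contDiff_momentum hu hα h v
  have m' := contDiff_momentum hu' hα' h v
  have w : ContDiff ℝ 1 u := hu.of_le (by norm_cast)
  have w' : ContDiff ℝ 1 u' := hu'.of_le (by norm_cast)
  exact ((p.mul m).mul (contDiff_conj (p'.mul w'))).add ((p.mul w).mul (contDiff_conj (p'.mul m')))

/-- The two phases bring the different potentials `α` and `α'` to the common `α₀`, for which
`momentum_green` applies. -/
theorem fderiv_current {v : ℝ × ℝ} {α α' α₀ σ σ' : ℝ × ℝ → ℝ} {u u' : ℝ × ℝ → ℂ} (hh : h ≠ 0)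
    (hα : ContDiff ℝ 1 α) (hα' : ContDiff ℝ 1 α') (hσ : ContDiff ℝ 1 σ) (hσ' : ContDiff ℝ 1 σ')
    (hu : ContDiff ℝ ∞ u) (hu' : ContDiff ℝ ∞ u') {x : ℝ × ℝ}
    (hgrad : fderiv ℝ σ x v = α₀ x - α x) (hgrad' : fderiv ℝ σ' x v = α₀ x - α' x) :
    -Complex.I * h * fderiv ℝ (current h v α α' σ σ' u u') x v
      = (phase h σ x * momentum h v α (momentum h v α u) x)
          * (starRingEnd ℂ) (phase h σ' x * u' x)
        - (phase h σ x * u x)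
          * (starRingEnd ℂ) (phase h σ' x * momentum h v α' (momentum h v α' u') x) := by
  have p := (contDiff_phase hσ h).differentiable one_ne_zero x
  have p' := (contDiff_phase hσ' h).differentiable one_ne_zero x
  have m := (contDiff_momentum hu hα h v).differentiable one_ne_zero x
  have m' := (contDiff_momentum hu' hα' h v).differentiable one_ne_zero x
  have w : DifferentiableAt ℝ u x := hu.differentiable (by simp) x
  have w' : DifferentiableAt ℝ u' x := hu'.differentiable (by simp) x
  have s := hσ.differentiable one_ne_zero x
  have s' := hσ'.differentiable one_ne_zero x
  have := momentum_green (α := α₀) (p.mul w) (p.mul m) (p'.mul w') (p'.mul m')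
    (momentum_phase_mul hh s w hgrad) (momentum_phase_mul hh s' w' hgrad')
  have e := momentum_phase_mul hh s m hgrad
  have e' := momentum_phase_mul hh s' m' hgrad'
  rw [← e, ← e']
  exact this

theorem current_bound {v : ℝ × ℝ} {α α' σ σ' : ℝ × ℝ → ℝ} {u u' : ℝ × ℝ → ℂ} (y : ℝ × ℝ) :
    ‖current h v α α' σ σ' u u' y‖
      ≤ ‖momentum h v α u y‖ * ‖u' y‖ + ‖u y‖ * ‖momentum h v α' u' y‖ := by
  refine (norm_add_le _ _).trans (le_of_eq ?_)
  simp only [norm_mul, RCLike.norm_conj, norm_phase, one_mul]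

theorem momentum₁_right (h L : ℝ) (β : ℝ → ℝ) (φ : ℝ × ℝ → ℝ) (x : ℝ × ℝ) :
    momentum₁ h (rightPotential L β) (fun y => ((φ (reflection y) : ℝ) : ℂ)) x
      = (starRingEnd ℂ) (momentum₁ h (leftPotential L β) (fun y => (φ y : ℂ)) (reflection x)) := by
  have := congrFun (momentum₁_conj_reflection (rightPotential_eq L β) h (fun y => (φ y : ℂ))) x
  simpa only [Complex.conj_ofReal] using this

theorem momentum₂_right (h L : ℝ) (β : ℝ → ℝ) (φ : ℝ × ℝ → ℝ) (x : ℝ × ℝ) :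
    momentum₂ h (rightPotential L β) (fun y => ((φ (reflection y) : ℝ) : ℂ)) x
      = -(starRingEnd ℂ) (momentum₂ h (leftPotential L β) (fun y => (φ y : ℂ)) (reflection x)) := by
  have := congrFun (momentum₂_conj_reflection (rightPotential_eq L β) h (fun y => (φ y : ℂ))) x
  simpa only [Complex.conj_ofReal] using this

/-- The normal current of the quasimodes. -/
noncomputable def current₁ (h L : ℝ) (β χ : ℝ → ℝ) (A : ℝ × ℝ → ℝ × ℝ) (φ : ℝ × ℝ → ℝ) :
    ℝ × ℝ → ℂ :=
  current h (1, 0) (fun y => (leftPotential L β y).1) (fun y => (rightPotential L β y).1)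
    (sigmaLeft L β A) (sigmaRight L β A) (fun y => (χ y.1 : ℂ) * (φ y : ℂ))
    fun y => ((φ (reflection y) : ℝ) : ℂ)

/-- The tangential current of the quasimodes. -/
noncomputable def current₂ (h L : ℝ) (β χ : ℝ → ℝ) (A : ℝ × ℝ → ℝ × ℝ) (φ : ℝ × ℝ → ℝ) :
    ℝ × ℝ → ℂ :=
  current h (0, 1) (fun y => (leftPotential L β y).2) (fun y => (rightPotential L β y).2)
    (sigmaLeft L β A) (sigmaRight L β A) (fun y => (χ y.1 : ℂ) * (φ y : ℂ))
    fun y => ((φ (reflection y) : ℝ) : ℂ)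

/-- Both one-well eigenvalues equal the same real `μ`, so the eigenvalue terms cancel and only the
commutator survives. The strip is where both gauge functions have the right gradient. -/
theorem divergence_current (hβ : IsProfile a b₀ b₁ β) (ha : 0 < a) (haL : a < L / 2)
    (hA : ContDiff ℝ 1 A) (hAB : ∀ x, curl A x = doubleField a L b₁ β x) (hh : 0 < h)
    (hφ : IsPositiveGroundstate h (leftPotential L β) μ φ) (hχ : ContDiff ℝ ∞ χ) {x : ℝ × ℝ}
    (hx : x.1 < L / 2 - a) (hx' : -(L / 2 - a) < x.1) :
    -Complex.I * h * (partial₁ (current₁ h L β χ A φ) x + partial₂ (current₂ h L β χ A φ) x)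
      = (phase h (sigmaLeft L β A) x * commutator h L β χ φ x)
        * (starRingEnd ℂ) (phase h (sigmaRight L β A) x * ((φ (reflection x) : ℝ) : ℂ)) := by
  have hAl := contDiff_leftPotential hβ L
  have hAr := contDiff_rightPotential hβ L
  have hσl := contDiff_sigmaLeft hβ L hA
  have hσr := contDiff_sigmaRight hβ L hA
  have hu := contDiff_cutoff_mul hχ (contDiff_ofReal_comp hφ.smooth)
  have hφr := hφ.reflect (rightPotential_eq L β)
  have hu' := contDiff_ofReal_comp hφr.smooth
  have gl := fderiv_sigmaLeft hβ ha haL hA hAB hx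
  have gr := fderiv_sigmaRight hβ ha haL hA hAB hx'
  have c1 := fderiv_current (α₀ := fun y => (A y).1) (v := (1, 0)) hh.ne' hAl.fst hAr.fst hσl hσr
    hu hu' (x := x) (by rw [gl]; ring) (by rw [gr]; ring)
  have c2 := fderiv_current (α₀ := fun y => (A y).2) (v := (0, 1)) hh.ne' hAl.snd hAr.snd hσl hσr
    hu hu' (x := x) (by rw [gl]; ring) (by rw [gr]; ring)
  have el := magneticLaplacian_cutoff_groundstate hβ hφ hχ x
  have er := hφr.equation x
  rw [magneticLaplacian, momentum₁_eq, momentum₂_eq] at el er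
  rw [partial₁, partial₂, current₁, current₂, mul_add, c1, c2]
  have er' := congrArg (starRingEnd ℂ) er
  simp only [map_mul, map_add, Complex.conj_ofReal] at er' ⊢
  linear_combination (phase h (sigmaLeft L β A) x * (starRingEnd ℂ) (phase h (sigmaRight L β A) x)
      * ((φ (reflection x) : ℝ) : ℂ)) * el
    - (phase h (sigmaLeft L β A) x * (starRingEnd ℂ) (phase h (sigmaRight L β A) x)
      * ((χ x.1 : ℂ) * (φ x : ℂ))) * er'

theorem momentum₁_cutoff_of_eventually_one {α : ℝ × ℝ → ℝ} {v : ℝ × ℝ} {w : ℝ × ℝ → ℂ}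
    (hχ : IsLeftCutoff a L η χ) {x : ℝ × ℝ} (hx : x.1 < L / 2 - a - η) :
    momentum h v α (fun y => (χ y.1 : ℂ) * w y) x = momentum h v α w x := by
  refine momentum_congr ?_
  filter_upwards [(isOpen_lt continuous_fst continuous_const).mem_nhds hx] with y hy
  rw [hχ.eq_one _ hy]
  simp

/-- On the line the two groundstates agree and their normal momenta are conjugate, so the two halves
of the current are equal; `k` appears as `-2` times the first component of `A_ℓ`. -/
theorem current₁_symmetryLine (hβ : IsProfile a b₀ b₁ β) (ha : 0 < a) (haL : a < L / 2)
    (hA : ContDiff ℝ 1 A) (hA₁ : ∀ x, (A x).1 = 0)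
    (hAB : ∀ x, curl A x = doubleField a L b₁ β x) (hh : 0 < h)
    (hφ : ContDiff ℝ ∞ φ) (hηL : η < L / 2 - a)
    (hχ : IsLeftCutoff a L η χ) (y : ℝ) :
    current₁ h L β χ A φ (0, y) = -Complex.I * h * interactionIntegrand h L β A φ y := by
  have h0 : ((0 : ℝ), y).1 < L / 2 - a - η := by
    change (0 : ℝ) < _
    linarith
  have hs : reflection ((0 : ℝ), y) = (0, y) := by simp
  have hr := momentum₁_right h L β φ (0, y)
  rw [hs, momentum₁_eq, momentum₁_eq] at hr
  have hk := kCoeff_eq_potentials hβ ha haL hA hA₁ hAB y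
  rw [rightPotential_eq, hs] at hk
  have hh' : (h : ℂ) ≠ 0 := Complex.ofReal_ne_zero.2 hh.ne'
  rw [current₁, current, momentum₁_cutoff_of_eventually_one hχ h0, hr, hs, hχ.eq_one _ h0,
    momentum_ofReal hφ, interactionIntegrand, hk, partial₁, theta, ← phase_mul_conj_phase]
  simp only [map_mul, map_sub, map_neg, Complex.conj_I, Complex.conj_ofReal, Complex.ofReal_one]
  push_cast
  field_simp
  linear_combination (-2 * phase h (sigmaLeft L β A) (0, y) *
    (starRingEnd ℂ) (phase h (sigmaRight L β A) (0, y))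
      * ((leftPotential L β (0, y)).1 : ℂ) * (φ (0, y) : ℂ) ^ 2) * Complex.I_sq

theorem current₁_symmetryLine_bound (hβ : IsProfile a b₀ b₁ β) (hb₀ : 0 < b₀) (hh : 0 < h)
    (haL : a < L / 2) (ha : 0 < a) (hφ : IsPositiveGroundstate h (leftPotential L β) μ φ)
    (hηL : η < L / 2 - a) (hχ : IsLeftCutoff a L η χ) :
    ∃ K, ∀ y : ℝ, ‖current₁ h L β χ A φ (0, y)‖ ≤ K * (1 + y ^ 2)⁻¹ := by
  obtain ⟨C, hC0, hC⟩ := groundstate_momentum_bounds hβ hb₀ hh (by linarith) hφ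
  refine ⟨C * C + C * C, fun y => ?_⟩
  have h0 : ((0 : ℝ), y).1 < L / 2 - a - η := by
    change (0 : ℝ) < _
    linarith
  obtain ⟨c1, c2, -, -⟩ := hC (0, y)
  have hs : reflection ((0 : ℝ), y) = (0, y) := by simp
  have hr := momentum₁_right h L β φ (0, y)
  have hp := hφ.pos (0, y)
  have hm : 0 < (1 + y ^ 2)⁻¹ := by positivity
  refine (current_bound _).trans ?_
  rw [← momentum₁_eq h (rightPotential L β), hr, momentum₁_cutoff_of_eventually_one hχ h0,
    ← momentum₁_eq, hχ.eq_one _ h0]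
  simp only [hs, RCLike.norm_conj, Complex.ofReal_one, one_mul, Complex.norm_real,
    Real.norm_eq_abs, abs_of_pos hp]
  simp only at c1
  set P := ‖momentum₁ h (leftPotential L β) (fun y => (φ y : ℂ)) (0, y)‖
  have hP : 0 ≤ P := norm_nonneg _
  calc P * φ (0, y) + φ (0, y) * P ≤ C * (C * (1 + y ^ 2)⁻¹) + C * (1 + y ^ 2)⁻¹ * C := by gcongr
    _ = _ := by ring

theorem current₂_bound (hβ : IsProfile a b₀ b₁ β) (hb₀ : 0 < b₀) (hh : 0 < h)
    (hL : 0 < L) (hφ : IsPositiveGroundstate h (leftPotential L β) μ φ) (hχ : ContDiff ℝ ∞ χ)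
    (c : ℝ) :
    ∃ K, ∀ x : ℝ × ℝ, x.1 ∈ Icc 0 c → ‖current₂ h L β χ A φ x‖ ≤ K * (1 + x.2 ^ 2)⁻¹ := by
  obtain ⟨C, hC0, hC⟩ := groundstate_momentum_bounds hβ hb₀ hh hL hφ
  obtain ⟨k, hk⟩ := (isCompact_Icc (a := 0) (b := c)).exists_bound_of_continuousOn
    hχ.continuous.continuousOn
  refine ⟨k * C * C + k * C * C, fun x hx => ?_⟩
  obtain ⟨c1, -, c3, -⟩ := hC x
  obtain ⟨d1, -, d3, -⟩ := hC (reflection x)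
  have hr := momentum₂_right h L β φ x
  have hp := hφ.pos x
  have hp' := hφ.pos (reflection x)
  have hm : 0 < (1 + x.2 ^ 2)⁻¹ := by positivity
  have hkx := hk x.1 hx
  have hk0 : 0 ≤ k := (norm_nonneg _).trans hkx
  have hw : Differentiable ℝ fun y => (φ y : ℂ) :=
    (contDiff_ofReal_comp hφ.smooth).differentiable (by simp)
  refine (current_bound _).trans ?_
  rw [← momentum₂_eq h (rightPotential L β), hr,
    momentum_cutoff_mul (hχ.differentiable (by simp) _) (hw x), ← momentum₂_eq]
  simp only [Complex.ofReal_zero, mul_zero, zero_mul, sub_zero, norm_mul, norm_neg,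
    RCLike.norm_conj, Complex.norm_real]
  rw [Real.norm_eq_abs (φ x), Real.norm_eq_abs (φ (reflection x)), abs_of_pos hp, abs_of_pos hp']
  have d1' : φ (reflection x) ≤ C * (1 + x.2 ^ 2)⁻¹ := d1
  calc _ ≤ k * C * (C * (1 + x.2 ^ 2)⁻¹) + k * (C * (1 + x.2 ^ 2)⁻¹) * C := by gcongr
    _ = _ := by ring

theorem integrable_interactionIntegrand (hβ : IsProfile a b₀ b₁ β) (ha : 0 < a) (haL : a < L / 2)
    (hb₀ : 0 < b₀) (hA : ContDiff ℝ 1 A) (hA₁ : ∀ x, (A x).1 = 0)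
    (hAB : ∀ x, curl A x = doubleField a L b₁ β x) (hh : 0 < h)
    (hφ : IsPositiveGroundstate h (leftPotential L β) μ φ) (hηL : η < L / 2 - a)
    (hχ : IsLeftCutoff a L η χ) :
    Integrable (fun y => current₁ h L β χ A φ (0, y))
      ∧ Integrable (interactionIntegrand h L β A φ) := by
  obtain ⟨K, hK⟩ := current₁_symmetryLine_bound (A := A) hβ hb₀ hh haL ha hφ hηL hχ
  have hF : ContDiff ℝ 1 (current₁ h L β χ A φ) :=
    contDiff_current (contDiff_leftPotential hβ L).fst (contDiff_rightPotential hβ L).fst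
      (contDiff_sigmaLeft hβ L hA) (contDiff_sigmaRight hβ L hA)
      (contDiff_cutoff_mul hχ.smooth (contDiff_ofReal_comp hφ.smooth))
      (contDiff_ofReal_comp (hφ.reflect (rightPotential_eq L β)).smooth) h
  have hint : Integrable fun y => current₁ h L β χ A φ (0, y) :=
    (integrable_inv_one_add_sq.const_mul K).mono'
      (hF.continuous.comp (Continuous.prodMk_right (0 : ℝ))).aestronglyMeasurable (.of_forall hK)
  refine ⟨hint, ?_⟩
  have e : interactionIntegrand h L β A φ
      = fun y => (Complex.I / h) * current₁ h L β χ A φ (0, y) := by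
    funext y
    have hh' : (h : ℂ) ≠ 0 := Complex.ofReal_ne_zero.2 hh.ne'
    rw [current₁_symmetryLine hβ ha haL hA hA₁ hAB hh hφ.smooth hηL hχ]
    field_simp
    linear_combination (interactionIntegrand h L β A φ y) * Complex.I_sq
  rw [e]
  exact hint.const_mul _

theorem scalarProduct_eq_interaction (hβ : IsProfile a b₀ b₁ β) (ha : 0 < a) (haL : a < L / 2)
    (hb₀ : 0 < b₀) (hA : ContDiff ℝ 1 A) (hA₁ : ∀ x, (A x).1 = 0)
    (hAB : ∀ x, curl A x = doubleField a L b₁ β x) (hh : 0 < h)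
    (hφ : IsPositiveGroundstate h (leftPotential L β) μ φ) (hη : 0 < η) (hηL : η < L / 2 - a)
    (hχ : IsLeftCutoff a L η χ) (hχ' : IsRightCutoff a L η χ') :
    scalarProduct (residual h A μ (quasimode h χ (sigmaLeft L β A) φ))
        (quasimode h χ' (sigmaRight L β A) fun x => φ (reflection x))
      = (h : ℂ) ^ 2 * ∫ y : ℝ, interactionIntegrand h L β A φ y := by
  have hL : 0 < L := by linarith
  have hh' : (h : ℂ) ≠ 0 := Complex.ofReal_ne_zero.2 hh.ne'
  have hφr := hφ.reflect (rightPotential_eq L β)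
  set D : ℝ × ℝ → ℂ := fun x => (phase h (sigmaLeft L β A) x * commutator h L β χ φ x)
    * (starRingEnd ℂ) (phase h (sigmaRight L β A) x * ((φ (reflection x) : ℝ) : ℂ)) with hD
  have hDzero : ∀ x : ℝ × ℝ, x.1 ∉ Icc (L / 2 - a - η) (L / 2 - a - η / 2) → D x = 0 :=
    fun x hx => by simp only [hD, commutator_eq_zero hχ h β φ hx, mul_zero, zero_mul]
  have hscalar : scalarProduct (residual h A μ (quasimode h χ (sigmaLeft L β A) φ))
      (quasimode h χ' (sigmaRight L β A) fun x => φ (reflection x)) = ∫ x, D x := by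
    unfold scalarProduct
    congr 1
    funext x
    rw [residual_quasimode hβ ha haL hA hAB hh hφ hη hχ, quasimode_eq]
    by_cases hx : x.1 ∈ Icc (L / 2 - a - η) (L / 2 - a - η / 2)
    · beta_reduce
      -- As `η < L / 2 - a`, the support of the commutator lies in `x.1 > 0`, where the right cutoff
      -- is `1`.
      rw [hχ'.eq_one x.1 (by linarith [hx.1]), Complex.ofReal_one, one_mul]
    · rw [hDzero x hx, commutator_eq_zero hχ h β φ hx, mul_zero, zero_mul]
  have hσl := contDiff_sigmaLeft hβ L hA
  have hσr := contDiff_sigmaRight hβ L hA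
  have hu := contDiff_cutoff_mul hχ.smooth (contDiff_ofReal_comp hφ.smooth)
  have hu' := contDiff_ofReal_comp hφr.smooth
  have hDint : Integrable D := by
    obtain ⟨K, hK⟩ := commutator_bounds hβ hb₀ hh hL hφ hχ
    obtain ⟨C, hC0, hC⟩ := groundstate_momentum_bounds hβ hb₀ hh hL hφ
    have hDc : Continuous D :=
      ((contDiff_phase hσl h).continuous.mul (continuous_commutator hβ hφ hχ.smooth)).mul
        (Complex.continuous_conj.comp ((contDiff_phase hσr h).continuous.mul hu'.continuous))
    refine integrable_of_strip_bound (C := K * C) hDc (fun x => ?_) hDzero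
    have hp := hφ.pos (reflection x)
    have hK0 : 0 ≤ K := (norm_nonneg _).trans (hK x).1
    have hφC : φ (reflection x) ≤ C * (1 + x.2 ^ 2)⁻¹ := (hC (reflection x)).1
    simp only [hD, norm_mul, RCLike.norm_conj, norm_phase, one_mul, Complex.norm_real,
      Real.norm_eq_abs, abs_of_pos hp]
    calc _ ≤ K * (C * (1 + x.2 ^ 2)⁻¹) := by
          gcongr
          exact (hK x).1
      _ = _ := by ring
  have hF₁ : ContDiff ℝ 1 (current₁ h L β χ A φ) :=
    contDiff_current (contDiff_leftPotential hβ L).fst (contDiff_rightPotential hβ L).fst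
      hσl hσr hu hu' h
  have hF₂ : ContDiff ℝ 1 (current₂ h L β χ A φ) :=
    contDiff_current (contDiff_leftPotential hβ L).snd (contDiff_rightPotential hβ L).snd
      hσl hσr hu hu' h
  -- Strictly between the end of the left cutoff and the edge of the region where the left gauge is
  -- valid.
  set c := L / 2 - a - η / 4 with hc
  have hc0 : 0 < c := by linarith
  obtain ⟨K₂, hK₂⟩ := current₂_bound (A := A) hβ hb₀ hh hL hφ hχ.smooth c
  have hend : ∀ y, current₁ h L β χ A φ (c, y) = 0 := fun y => by
    have hcy : L / 2 - a - η / 2 < ((c, y) : ℝ × ℝ).1 := by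
      change L / 2 - a - η / 2 < c
      linarith
    have hzero : (fun y : ℝ × ℝ => (χ y.1 : ℂ) * (φ y : ℂ)) =ᶠ[nhds (c, y)] fun _ => 0 := by
      filter_upwards [(isOpen_lt continuous_const continuous_fst).mem_nhds hcy] with z hz
      rw [hχ.eq_zero _ hz]
      simp
    rw [current₁, current, momentum_congr hzero, hzero.eq_of_nhds]
    simp [momentum]
  -- The factor `i / h` is the inverse of the `-ih` in `divergence_current`.
  have key := integral_divergence_strip hF₁ hF₂ (D := fun x => (Complex.I / h) * D x) hc0 hend hK₂
    (integrable_interactionIntegrand hβ ha haL hb₀ hA hA₁ hAB hh hφ hηL hχ).1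
    (hDint.const_mul _)
    (fun x hx => by
      rw [hDzero x fun hm => hx ⟨by linarith [hm.1], by linarith [hm.2]⟩, mul_zero])
    (fun x hx => by
      have := divergence_current hβ ha haL hA hAB hh hφ hχ.smooth (x := x)
        (by linarith [hx.2]) (by linarith [hx.1])
      simp only [hD]
      rw [← this]
      field_simp
      linear_combination (partial₁ (current₁ h L β χ A φ) x
        + partial₂ (current₂ h L β χ A φ) x) * Complex.I_sq)
  rw [integral_const_mul] at key
  simp only [current₁_symmetryLine hβ ha haL hA hA₁ hAB hh hφ.smooth hηL hχ] at key
  rw [integral_const_mul] at key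
  rw [hscalar]
  field_simp at key
  exact key

end Interaction

end MagneticDoubleWell

/-! ### The main theorem. -/

open MagneticDoubleWell in
theorem proposition4p2
    (a L b₀ b₁ : ℝ) (ha : 0 < a) (haL : a < L / 2) (hb₀ : 0 < b₀) (hb : b₀ < b₁)
    (β : ℝ → ℝ) (hβ : IsProfile a b₀ b₁ β)
    (A : ℝ × ℝ → ℝ × ℝ) (hA : ContDiff ℝ ∞ A) (hA₁ : ∀ x, (A x).1 = 0)
    (hAB : ∀ x, curl A x = doubleField a L b₁ β x) :
    -- `k` is meaningful on the symmetry line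
    (∀ x₂ : ℝ, DifferentiableAt ℝ (sigmaLeft L β A) (0, x₂)
        ∧ DifferentiableAt ℝ (sigmaRight L β A) (0, x₂))
    -- the phase and the coefficient
    ∧ (∀ x, theta L β A x
        = segmentIntegral (fun y => leftPotential L β y - rightPotential L β y) x)
    ∧ (∀ x₂ : ℝ, theta L β A (0, x₂)
        = b₁ * L * x₂ / 2 + 2 * fluxDifference a L b₁ β * Real.arctan (2 * x₂ / L))
    ∧ (∀ x₂ : ℝ, kCoeff L β A (0, x₂)
        = b₁ * x₂ + 2 * fluxDifference a L b₁ β * x₂ / (L ^ 2 / 4 + x₂ ^ 2))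
    -- the integral formula for `w_h`
    ∧ ∀ (h : ℝ), 0 < h →
      ∀ (μ : ℝ) (φl : ℝ × ℝ → ℝ), IsPositiveGroundstate h (leftPotential L β) μ φl →
      ∀ (μr : ℝ) (φr : ℝ × ℝ → ℝ), IsPositiveGroundstate h (rightPotential L β) μr φr →
      ∀ (η : ℝ), 0 < η → η < L / 2 - a →
      ∀ (χl χr : ℝ → ℝ), IsLeftCutoff a L η χl → IsRightCutoff a L η χr →
        -- both entries of the scalar product `w_h` are in `L²`, the line integral converges
        MemLp (residual h A μ (quasimode h χl (sigmaLeft L β A) φl)) 2 volume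
        ∧ MemLp (quasimode h χr (sigmaRight L β A) φr) 2 volume
        ∧ Integrable (interactionIntegrand h L β A φl) volume
        ∧ scalarProduct (residual h A μ (quasimode h χl (sigmaLeft L β A) φl))
              (quasimode h χr (sigmaRight L β A) φr)
            = (h : ℂ) ^ 2 * ∫ x₂ : ℝ, interactionIntegrand h L β A φl x₂ := by
  have hA' : ContDiff ℝ 1 A := hA.of_le (by norm_cast)
  have hσl := contDiff_sigmaLeft hβ L hA'
  have hσr := contDiff_sigmaRight hβ L hA'
  refine ⟨fun x₂ => ⟨hσl.differentiable one_ne_zero _, hσr.differentiable one_ne_zero _⟩,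
    theta_eq_segmentIntegral hβ L hA', theta_symmetryLine hβ ha haL hA',
    kCoeff_symmetryLine hβ ha haL hA' hA₁ hAB, ?_⟩
  intro h hh μ φl hl μr φr hr η hη hηL χl χr hχl hχr
  refine ⟨memLp_residual_quasimode hβ ha haL hb₀ hA' hAB hh hl hη hχl,
    memLp_quasimode hσr.continuous hr hχr,
    (integrable_interactionIntegrand hβ ha haL hb₀ hA' hA₁ hAB hh hl hηL hχl).2, ?_⟩
  -- The reflected right groundstate is a positive groundstate of the left well, so uniqueness
  -- applies.
  have hφr : φr = fun x => φl (reflection x) := by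
    have := groundstate_unique hβ hb₀ hh hl (hr.reflect (leftPotential_eq_reflection L β))
    funext x
    simp only [this, reflection_reflection]
  rw [hφr]
  exact scalarProduct_eq_interaction hβ ha haL hb₀ hA' hA₁ hAB hh hl hη hηL hχl hχr
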